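/- **Setting.** Fix $d\ge 3$, $\alpha\in(0,1)$, $\beta>0$. Let $(\mathcal G_n)$ be a sequence of finite simple connected $d$-regular graphs with vertex sets $\mathcal V_n$, where $|\mathcal V_n|=N_n$ is increasing with $N_n\to\infty$, such that for every $n$: (i) for every $x\in\mathcal V_n$ the ball of radius $\lfloor \alpha\log_{d-1}N_n\rfloor$ around $x$ contains at most one cycle; (ii) the spectral gap of $\mathcal G_n$ (one minus the second largest eigenvalue of the transition matrix of the simple random walk) is at least $\beta$. The zero-average Gaussian free field $\Psi_{\mathcal G_n}$ is the centred Gaussian process on $\mathcal V_n$ with covariance $\frac12\sum_{k\ge0}\big(\bar P_x(X_k=y)-\frac1{N_n}\big)$, where $X$ is the lazy simple random walk (holding probability $\frac12$). The Gaussian free field $\varphi$ on the infinite $d$-regular tree $\mathbb T_d$ with root $\mathrm o$ is the centred Gaussian process whose covariance is the Green function of the (discrete-time) simple random walk on $\mathbb T_d$. For a graph $G$ let $\tilde G$ be the graph obtained by adding a vertex in the middle of every edge, $\tilde Q_G$ the transition matrix of the simple random walk on $\tilde G$, and, for finite $G$, $\Pi_G$ the orthogonal projection in $\ell^2(\deg_{\tilde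 G})$ onto the span of $\mathbf 1$ and of the function equal to $1$ on $V(G)$ and $-1$ on $E(G)$. A *noise* on $\tilde G$ is a family $(Z_k(\tilde x))_{k\ge0,\,\tilde x\in V(\tilde G)}$ of independent centred Gaussian variables with $\operatorname{Var}Z_k(\tilde x)=\frac{d/2}{\deg_{\tilde G}(\tilde x)}$. Write $B(x,r)$ for the closed ball of radius $r$ in the graph distance. A vertex $x$ is $r$-treelike if $B(x,r)$ contains no cycle. If $x\in\mathcal V_n$ is $2r$-treelike, fix a graph isomorphism $\rho_x:B_{\mathcal G_n}(x,2r)\to B_{\mathbb T_d}(\mathrm o,2r)$ with $\rho_x(x)=\mathrm o$, and let $\tilde\rho_x:B_{\tilde{\mathcal G}_n}(x,4r)\to B_{\tilde{\mathbb T}_d}(\mathrm o,4r)$ be its natural extension to the subdivided graphs. **Proposition.** There are constants $c,C,\kappa\in(0,\infty)$ and $r_0\in\mathbb N$, depending only on $d,\alpha,\beta$, such that for all such sequences, all $n$, all $r\in\mathbb N=\{0,1,\dots\}$, and all $2r$-treelike $x,x'\in\mathcal V_n$ with $B_{\mathcal G_n}(x,2r)\cap B_{\mathcal G_n}(x',2r)=\emptyset$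 (and every choice of $\rho_x,\rho_{x'}$), there exist a probability space $(\Omega,\mathcal A,\mathbb Q)$ and on it a zero-average Gaussian free field $\Psi$ on $\mathcal G_n$, two independent Gaussian free fields $\varphi,\varphi'$ on $\mathbb T_d$, a noise $Z$ on $\tilde{\mathcal G}_n$, and two independent noises $\mathtt Z,\mathtt Z'$ on $\tilde{\mathbb T}_d$ such that: 1. almost surely, $\Psi(y)=\sum_{k\ge0}\big((\mathrm{Id}-\Pi_{\mathcal G_n})\tilde Q_{\mathcal G_n}^kZ_k\big)(y)$ for all $y\in\mathcal V_n$, and $\varphi(v)=\sum_{k\ge0}(\tilde Q_{\mathbb T_d}^k\mathtt Z_k)(v)$, $\varphi'(v)=\sum_{k\ge0}(\tilde Q_{\mathbb T_d}^k\mathtt Z'_k)(v)$ for all $v\in \mathbb T_d$, with (absolutely) convergent series; 2. almost surely, $\mathtt Z_k(\tilde\rho_x(\tilde y))=Z_k(\tilde y)$ for all $k\le2r$, $\tilde y\in B_{\tilde{\mathcal G}_n}(x,4r)$, and $\mathtt Z'_k(\tilde\rho_{x'}(\tilde y))=Z_k(\tilde y)$ for all $k\le2r$, $\tilde y\in B_{\tilde{\mathcal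 G}_n}(x',4r)$; otherwise the noises are independent, that is, all the variables $Z_k(\tilde y)$, together with those variables $\mathtt Z_k(\tilde v)$, $\mathtt Z'_k(\tilde v)$ for which $k>2r$ or $\tilde v\notin B_{\tilde{\mathbb T}_d}(\mathrm o,4r)$, are independent; 3. with $D(x,r)=\max_{y\in B_{\mathcal G_n}(x,r)}|\Psi(y)-\varphi(\rho_x(y))|$ and $D(x',r)=\max_{y\in B_{\mathcal G_n}(x',r)}|\Psi(y)-\varphi'(\rho_{x'}(y))|$, for all $\varepsilon>0$, $$\mathbb Q\big[\max\{D(x,r),D(x',r)\}>\varepsilon\big]\le C\,d(d-1)^r\Big(\exp\Big(-\frac{\kappa\,\varepsilon^2e^{cr}}{18}\Big)+\exp\Big(-\frac{\varepsilon^2N_n}{9(r+1)}\Big)\Big),$$ and if $r\ge r_0$ the same bound holds with $\kappa$ replaced by $1$: $$\mathbb Q\big[\max\{D(x,r),D(x',r)\}>\varepsilon\big]\le C\,d(d-1)^r\Big(\exp\Big(-\frac{\varepsilon^2e^{cr}}{18}\Big)+\exp\Big(-\frac{\varepsilon^2N_n}{9(r+1)}\Big)\Big).$$ -/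

import Mathlib

open MeasureTheory ProbabilityTheory Filter
open scoped NNReal ENNReal

noncomputable section

namespace GFFCoupling

/-! ### Graphs, balls, random walks -/

/-- The degree of a vertex (a genuine degree in a locally finite graph). -/
def deg {V : Type*} (G : SimpleGraph V) (x : V) : ℕ := (G.neighborSet x).ncard

/-- The closed ball of radius `r` around `x` in the graph distance. -/
def cball {V : Type*} (G : SimpleGraph V) (x : V) (r : ℕ) : Set V :=
  {y | G.edist x y ≤ (r : ℕ∞)}

theorem mem_cball_self {V : Type*} (G : SimpleGraph V) (x : V) (r : ℕ) : x ∈ cball G x r := by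
  simp [cball]

/-- The operator `Q` of the (usual) simple random walk on a locally finite graph:
`(Q f)(x) = ∑_y Q(x,y) f(y)` with `Q(x,y) = 1_{x ∼ y} / deg x`. In particular
`(Q^k 1_y)(x)` is the probability that the walk started at `x` is at `y` at time `k`. -/
def srwOp {V : Type*} (G : SimpleGraph V) (f : V → ℝ) (x : V) : ℝ :=
  (∑ᶠ y ∈ G.neighborSet x, f y) / (deg G x : ℝ)

/-- The operator of the lazy simple random walk. -/
def lazyOp {V : Type*} (G : SimpleGraph V) (f : V → ℝ) (x : V) : ℝ :=
  f x / 2 + srwOp G f x / 2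

/-- The indicator function of the point `y`. -/
def pointInd {V : Type*} (y : V) : V → ℝ := Set.indicator {y} (fun _ => (1 : ℝ))

/-- The law of the lazy walk at time `k`: the probability to be at `y`, starting from `x`. -/
def lazyProb {V : Type*} (G : SimpleGraph V) (k : ℕ) (x y : V) : ℝ :=
  ((lazyOp G)^[k] (pointInd y)) x

/-- The law of the simple random walk at time `k`. -/
def srwProb {V : Type*} (G : SimpleGraph V) (k : ℕ) (x y : V) : ℝ :=
  ((srwOp G)^[k] (pointInd y)) x

/-- The invariant distribution `deg x / (2 |E|)` of the walk on a finite graph. -/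
def invDist {V : Type*} (G : SimpleGraph V) (x : V) : ℝ :=
  (deg G x : ℝ) / (2 * (G.edgeSet.ncard : ℝ))

/-- The zero-average Green function of the lazy walk on a finite connected graph. -/
def zeroAvgGreen {V : Type*} (G : SimpleGraph V) (x y : V) : ℝ :=
  ∑' k : ℕ, (lazyProb G k x y - invDist G y)

/-- The Green function of the simple random walk on a (transient) graph. -/
def green {V : Type*} (G : SimpleGraph V) (x y : V) : ℝ := ∑' k : ℕ, srwProb G k x y

/-- The spectral gap of a finite graph: one minus the second largest eigenvalue (counted with
multiplicity) of the transition operator `Q`, i.e. the least `g` such that `1 - g` is an eigenvalue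
of `Q` on the orthogonal complement of the constants in `ℓ²(deg)`. -/
def spectralGap {V : Type*} (G : SimpleGraph V) : ℝ :=
  sInf {g : ℝ | ∃ f : V → ℝ, f ≠ 0 ∧ (∑ᶠ x, (deg G x : ℝ) * f x) = 0 ∧
    srwOp G f = fun x => (1 - g) * f x}

/-- `x` is `r`-treelike: there is no cycle in the ball of radius `r` around `x`. -/
def Treelike {V : Type*} (G : SimpleGraph V) (r : ℕ) (x : V) : Prop :=
  (G.induce (cball G x r)).IsAcyclic

/-- The graph contains at most one cycle (cycles being identified with their sets of edges). -/
def AtMostOneCycle {V : Type*} (G : SimpleGraph V) : Prop :=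
  ∀ (u v : V) (p : G.Walk u u) (q : G.Walk v v), p.IsCycle → q.IsCycle →
    {e | e ∈ p.edges} = {e | e ∈ q.edges}

/-- The standing assumptions on the sequence of graphs `G n`, with `N n` vertices. -/
structure GraphAssumption (d : ℕ) (α β : ℝ) (V : ℕ → Type*) (G : ∀ n, SimpleGraph (V n))
    (N : ℕ → ℕ) : Prop where
  pos : ∀ n, 0 < N n
  mono : Monotone N
  tendsto : Tendsto N atTop atTop
  finite : ∀ n, Finite (V n)
  card : ∀ n, Nat.card (V n) = N n
  connected : ∀ n, (G n).Connected
  regular : ∀ n x, deg (G n) x = d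
  oneCycle : ∀ n x, AtMostOneCycle
    ((G n).induce (cball (G n) x ⌊α * Real.logb ((d : ℝ) - 1) (N n : ℝ)⌋₊))
  gap : ∀ n, β ≤ spectralGap (G n)

/-! ### The regular tree -/

/-- Vertices of the `d`-regular tree: words over `d` letters without equal consecutive letters. -/
def TreeVertex (d : ℕ) : Type := {w : List (Fin d) // w.IsChain (fun a b => a ≠ b)}

/-- The root of the tree: the empty word. -/
def root (d : ℕ) : TreeVertex d := ⟨[], List.isChain_nil⟩

/-- The infinite `d`-regular tree: the neighbours of a word are obtained by adding or removing one
letter at its head. -/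
def tree (d : ℕ) : SimpleGraph (TreeVertex d) where
  Adj u v := (∃ a, u.1 = a :: v.1) ∨ (∃ a, v.1 = a :: u.1)
  symm := ⟨fun _ _ h => h.symm⟩
  loopless := ⟨fun u h => by
    rcases h with ⟨a, h⟩ | ⟨a, h⟩ <;> simpa using congrArg List.length h⟩

/-- Isomorphisms of the ball of radius `R` around `x` onto the ball of radius `R` around the root
of the `d`-regular tree which map `x` to the root. -/
def BallIso {V : Type*} (G : SimpleGraph V) (d : ℕ) (x : V) (R : ℕ) : Type _ :=
  {f : G.induce (cball G x R) ≃g (tree d).induce (cball (tree d) (root d) R) //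
    (f ⟨x, mem_cball_self G x R⟩).1 = root d}

/-! ### Subdivided graphs and the noise representation -/

/-- Vertices of the graph obtained by adding a vertex in the middle of every edge. -/
abbrev SubdivVertex {V : Type*} (G : SimpleGraph V) : Type _ := V ⊕ G.edgeSet

/-- The graph obtained from `G` by adding a vertex in the middle of every edge. -/
def subdiv {V : Type*} (G : SimpleGraph V) : SimpleGraph (SubdivVertex G) where
  Adj a b := (∃ (x : V) (e : G.edgeSet), a = Sum.inl x ∧ b = Sum.inr e ∧ x ∈ e.1) ∨
    (∃ (x : V) (e : G.edgeSet), b = Sum.inl x ∧ a = Sum.inr e ∧ x ∈ e.1)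
  symm := ⟨fun _ _ h => h.symm⟩
  loopless := ⟨fun u h => by
    rcases h with ⟨x, e, h1, h2, -⟩ | ⟨x, e, h1, h2, -⟩ <;> simp [h1] at h2⟩

/-- The map between subdivided graphs induced by a graph homomorphism. -/
def subdivMap {V W : Type*} {G : SimpleGraph V} {H : SimpleGraph W} (f : G →g H) :
    SubdivVertex G → SubdivVertex H :=
  Sum.map f f.mapEdgeSet

/-- The function equal to `1` on the original vertices and `-1` on the midpoints of edges. -/
def signFn {V : Type*} (G : SimpleGraph V) : SubdivVertex G → ℝ :=
  Sum.elim (fun _ => 1) (fun _ => -1)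

/-- The scalar product of `ℓ²(deg)` on the subdivision of a finite graph. -/
def inner2 {V : Type*} (G : SimpleGraph V) (f g : SubdivVertex G → ℝ) : ℝ :=
  ∑ᶠ z, f z * g z * (deg (subdiv G) z : ℝ)

/-- The orthogonal projection in `ℓ²(deg)` of the subdivided finite graph onto the span of the
(orthogonal) functions `1` and `signFn G`. -/
def proj {V : Type*} (G : SimpleGraph V) (f : SubdivVertex G → ℝ) (x : SubdivVertex G) : ℝ :=
  inner2 G f (fun _ => 1) / inner2 G (fun _ => 1) (fun _ => 1) +
    inner2 G f (signFn G) / inner2 G (signFn G) (signFn G) * signFn G x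

/-- `ξ^k(x) = ((Id - Π) Q^k Z_k)(x)` for a vertex `x` of the finite graph `G`, where `Q` is the
operator of the simple random walk on the subdivided graph. -/
def xi {V : Type*} (G : SimpleGraph V) (k : ℕ) (z : SubdivVertex G → ℝ) (x : V) : ℝ :=
  ((srwOp (subdiv G))^[k] z) (Sum.inl x) - proj G ((srwOp (subdiv G))^[k] z) (Sum.inl x)

/-- `ζ^k(x) = (Q^k Z_k)(x)` for a vertex `x` of the (infinite) graph `G`. -/
def zeta {V : Type*} (G : SimpleGraph V) (k : ℕ) (z : SubdivVertex G → ℝ) (x : V) : ℝ :=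
  ((srwOp (subdiv G))^[k] z) (Sum.inl x)

/-! ### Gaussian fields -/

/-- `X` is a centred Gaussian process with covariance function `K`. -/
structure IsCentredGaussianField {Ω T : Type*} [MeasurableSpace Ω] (μ : Measure Ω)
    (X : T → Ω → ℝ) (K : T → T → ℝ) : Prop where
  gaussian : IsGaussianProcess X μ
  centred : ∀ t, ∫ ω, X t ω ∂μ = 0
  cov : ∀ s t, covariance (X s) (X t) μ = K s t

/-- Zero-average Gaussian free field on a finite connected graph; `C₀` is the scaling constant. -/
def IsZeroAvgGFF {Ω V : Type*} [MeasurableSpace Ω] (μ : Measure Ω) (G : SimpleGraph V) (C₀ : ℝ)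
    (Ψ : V → Ω → ℝ) : Prop :=
  IsCentredGaussianField μ Ψ (fun x y => C₀ * (zeroAvgGreen G x y / (deg G y : ℝ)))

/-- Gaussian free field on the `d`-regular tree. -/
def IsTreeGFF {Ω : Type*} [MeasurableSpace Ω] (μ : Measure Ω) (d : ℕ)
    (φ : TreeVertex d → Ω → ℝ) : Prop :=
  IsCentredGaussianField μ φ (green (tree d))

/-- `Z = (Z_k(x))` is a family of independent centred Gaussian variables, indexed by `k ∈ ℕ` and
the vertices `x` of the subdivided graph, with variances `C₀ / deg x`. -/
structure IsNoise {Ω V : Type*} [MeasurableSpace Ω] (μ : Measure Ω) (G : SimpleGraph V) (C₀ : ℝ)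
    (Z : ℕ → SubdivVertex G → Ω → ℝ) : Prop where
  indep : iIndepFun (fun p : ℕ × SubdivVertex G => Z p.1 p.2) μ
  law : ∀ k x, HasLaw (Z k x) (gaussianReal 0 (C₀ / (deg (subdiv G) x : ℝ)).toNNReal) μ

/-! ### The coupling -/

/-- The inclusion of the subdivided ball of radius `R` (around `x`) into the subdivided graph. Its
image is the ball of radius `2R` around `x` of the subdivided graph, if `x` is `R`-treelike. -/
def ballIncl {V : Type*} (G : SimpleGraph V) (x : V) (R : ℕ) :
    SubdivVertex (G.induce (cball G x R)) → SubdivVertex G :=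
  subdivMap (SimpleGraph.Embedding.induce (cball G x R)).toHom

/-- The natural extension of a ball isomorphism to the subdivided balls. -/
def ballIsoExt {V : Type*} {G : SimpleGraph V} {d : ℕ} {x : V} {R : ℕ} (ρ : BallIso G d x R) :
    SubdivVertex (G.induce (cball G x R)) → SubdivVertex (tree d) :=
  fun u => ballIncl (tree d) (root d) R (subdivMap (ρ.1 : _ →g _) u)

/-- Space-time points `(k, z)` of the subdivided tree, `k ≤ R` and `z` in the subdivided ball of
radius `R` around the root, at which the noise on the tree is prescribed by the one on `G`. -/
def coupledSet (d R : ℕ) : Set (ℕ × SubdivVertex (tree d)) :=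
  {p | p.1 ≤ R ∧ p.2 ∈ Set.range (ballIncl (tree d) (root d) R)}

/-- A coupling, under `μ`, of the zero-average free field `Ψ` on the `d`-regular graph `G` and of
two independent free fields `φ`, `φ'` on the `d`-regular tree, together with the underlying noises
`Z`, `W`, `W'`. The noises agree (through the ball isomorphisms `ρ`, `ρ'` of radius `R`) up to time
`R` on the balls, and are otherwise independent. -/
structure IsCoupling {Ω V : Type*} [MeasurableSpace Ω] (μ : Measure Ω) (G : SimpleGraph V)
    (d R : ℕ) (x x' : V) (ρ : BallIso G d x R) (ρ' : BallIso G d x' R)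
    (Ψ : V → Ω → ℝ) (φ φ' : TreeVertex d → Ω → ℝ)
    (Z : ℕ → SubdivVertex G → Ω → ℝ) (W W' : ℕ → SubdivVertex (tree d) → Ω → ℝ) : Prop where
  zeroAvgGFF : IsZeroAvgGFF μ G ((d : ℝ) / 2) Ψ
  treeGFF : IsTreeGFF μ d φ
  treeGFF' : IsTreeGFF μ d φ'
  indep_fields : IndepFun (fun ω v => φ v ω) (fun ω v => φ' v ω) μ
  noise : IsNoise μ G ((d : ℝ) / 2) Z
  treeNoise : IsNoise μ (tree d) ((d : ℝ) / 2) W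
  treeNoise' : IsNoise μ (tree d) ((d : ℝ) / 2) W'
  indep_noises : IndepFun (fun ω (p : ℕ × SubdivVertex (tree d)) => W p.1 p.2 ω)
    (fun ω (p : ℕ × SubdivVertex (tree d)) => W' p.1 p.2 ω) μ
  repr : ∀ᵐ ω ∂μ, ∀ y, HasSum (fun k => xi G k (fun z => Z k z ω) y) (Ψ y ω)
  treeRepr : ∀ᵐ ω ∂μ, ∀ v, HasSum (fun k => zeta (tree d) k (fun z => W k z ω) v) (φ v ω)
  treeRepr' : ∀ᵐ ω ∂μ, ∀ v, HasSum (fun k => zeta (tree d) k (fun z => W' k z ω) v) (φ' v ω)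
  agree : ∀ᵐ ω ∂μ, ∀ k ≤ R, ∀ u, W k (ballIsoExt ρ u) ω = Z k (ballIncl G x R u) ω
  agree' : ∀ᵐ ω ∂μ, ∀ k ≤ R, ∀ u, W' k (ballIsoExt ρ' u) ω = Z k (ballIncl G x' R u) ω
  otherwise_indep : iIndepFun
    (Sum.elim (fun p : ℕ × SubdivVertex G => Z p.1 p.2)
      (Sum.elim (fun p : {p // p ∉ coupledSet d R} => W p.1.1 p.1.2)
        (fun p : {p // p ∉ coupledSet d R} => W' p.1.1 p.1.2))) μ

/-- `D(x, r)`: the maximum over the ball of radius `r` around `x` of `|Ψ(y) - φ(ρ(y))|`, where `ρ`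
is an isomorphism of the ball of radius `2r`. (For realisations `Ψ`, `φ` of the fields.) -/
def maxDiff {V : Type*} {G : SimpleGraph V} {d : ℕ} {x : V} {r : ℕ} (ρ : BallIso G d x (2 * r))
    (Ψ : V → ℝ) (φ : TreeVertex d → ℝ) : ℝ :=
  ⨆ y : {y : cball G x (2 * r) // y.1 ∈ cball G x r}, |Ψ y.1.1 - φ (ρ.1 y.1).1|

end GFFCoupling

end

/-!
The noise representation does most of the work. Two steps of the walk on the subdivided graph are
one step of the lazy walk (`srwOp_subdiv_two`), and by reversibility the field `Q ^ k Z_k`, seen at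
the original vertices, has covariance `lazyProb k x y / 2`, independently for different `k`
(`IsNoise.isCentredGaussianField_zeta`). On a finite graph the projection `Π` only subtracts the
average over the original vertices (`xi_eq`), so that the covariance becomes
`(lazyProb k x y - 1 / N) / 2`. Summing over `k` gives the zero-average field and, because the Green
function of the walk is half of that of the lazy walk (`hasSum_lazyProb_div_two`), the field on the
tree.

The variances of the layers decay geometrically, at a rate depending on `d` and `β` only. On the
tree the weight `(d - 1) ^ (-|v| / 2)` is mapped by `Q` below `2 √(d - 1) / d < 1` times itself
(`srwOp_treeWeight_le`), and on a finite graph the spectral gap bounds the lazy walk on functions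
of mean zero (`norm_centredLazy_le`).

All three noises are read off one countable family of independent Gaussian variables through
injective index maps with disjoint images on the two trees (`exists_isCoupling`). The walk started
in the ball of radius `r` stays inside the subdivided ball of radius `2 r` up to time `2 r`, hence
the layers `k ≤ 2 r` of the fields on the graph and on the tree differ exactly by the averages over
the graph (`zeta_ballMap`), whose sum has variance `(2 r + 1) / (2 N)`. The remaining layers have
total variance of order `θ ^ (2 r)`. Gaussian tail bounds for these three contributions
(`measureReal_abs_sub_gt_le`) and a union bound over the balls, which have at most `d (d - 1) ^ r`
points (`card_ball_le`), give the estimate.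
-/

noncomputable section

namespace GFFCoupling

/-! ### Centred Gaussian fields -/

section Gaussian

open Topology

variable {Ω S T : Type*} [MeasurableSpace Ω] {μ : Measure Ω}

theorem map_eq_gaussianReal_of_tendsto [IsProbabilityMeasure μ] {Y : ℕ → Ω → ℝ} {Y' : Ω → ℝ}
    {v : ℕ → ℝ≥0} {v' : ℝ≥0} (hY : ∀ n, AEMeasurable (Y n) μ) (hY' : AEMeasurable Y' μ)
    (hlaw : ∀ n, μ.map (Y n) = gaussianReal 0 (v n))
    (hlim : ∀ᵐ ω ∂μ, Tendsto (fun n => Y n ω) atTop (𝓝 (Y' ω)))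
    (hv : Tendsto v atTop (𝓝 v')) : μ.map Y' = gaussianReal 0 v' := by
  have := Measure.isProbabilityMeasure_map (μ := μ) hY'
  refine Measure.ext_of_charFun (funext fun t => ?_)
  have hint : ∀ {X : Ω → ℝ}, AEMeasurable X μ →
      charFun (μ.map X) t = ∫ ω, Complex.exp (t * X ω * Complex.I) ∂μ := fun {X} hX => by
    rw [charFun_apply_real, integral_map hX (by fun_prop)]
  have h1 : Tendsto (fun n => charFun (μ.map (Y n)) t) atTop (𝓝 (charFun (μ.map Y') t)) := by
    rw [hint hY']
    simp_rw [fun n => hint (hY n)]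
    refine tendsto_integral_of_dominated_convergence (fun _ => 1) (fun n => ?_)
      (integrable_const _) (fun n => ?_) ?_
    · exact (Complex.measurable_exp.comp_aemeasurable
        (((Complex.measurable_ofReal.comp_aemeasurable (hY n)).const_mul _).mul_const
          _)).aestronglyMeasurable
    · refine ae_of_all _ fun ω => ?_
      rw [← Complex.ofReal_mul, Complex.norm_exp_ofReal_mul_I]
    · filter_upwards [hlim] with ω hω
      exact (Complex.continuous_exp.tendsto _).comp
        ((((Complex.continuous_ofReal.tendsto _).comp hω).const_mul _).mul_const _)
  refine tendsto_nhds_unique h1 ?_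
  simp_rw [hlaw, charFun_gaussianReal]
  refine (Complex.continuous_exp.tendsto _).comp (tendsto_const_nhds.sub ?_)
  refine Tendsto.div_const (Tendsto.mul_const _ ?_) _
  exact (Complex.continuous_ofReal.tendsto _).comp ((NNReal.continuous_coe.tendsto _).comp hv)

namespace IsCentredGaussianField

variable {X : T → Ω → ℝ} {K : T → T → ℝ}

theorem isProbabilityMeasure (h : IsCentredGaussianField μ X K) : IsProbabilityMeasure μ :=
  h.gaussian.isProbabilityMeasure

theorem memLp (h : IsCentredGaussianField μ X K) (t : T) : MemLp (X t) 2 μ :=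
  (h.gaussian.hasGaussianLaw_eval t).memLp_two

theorem map_eq (h : IsCentredGaussianField μ X K) (t : T) :
    μ.map (X t) = gaussianReal 0 (K t t).toNNReal := by
  rw [(h.gaussian.hasGaussianLaw_eval t).map_eq_gaussianReal, h.centred,
    ← covariance_self (h.gaussian.aemeasurable t), h.cov]

theorem cov_self_nonneg (h : IsCentredGaussianField μ X K) (t : T) : 0 ≤ K t t := by
  rw [← h.cov, covariance_self (h.gaussian.aemeasurable t)]
  exact variance_nonneg _ _

theorem integral_sq (h : IsCentredGaussianField μ X K) (t : T) : ∫ ω, X t ω ^ 2 ∂μ = K t t := by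
  have := h.isProbabilityMeasure
  rw [← h.cov, covariance_self (h.gaussian.aemeasurable t),
    variance_of_integral_eq_zero (h.gaussian.aemeasurable t) (h.centred t)]

theorem comp (h : IsCentredGaussianField μ X K) (f : S → T) :
    IsCentredGaussianField μ (fun s => X (f s)) (fun s s' => K (f s) (f s')) :=
  ⟨h.gaussian.comp_right f, fun _ => h.centred _, fun _ _ => h.cov _ _⟩

/-- Finite linear combinations of a centred Gaussian field form a centred Gaussian field. -/
theorem sum (h : IsCentredGaussianField μ X K) (F : S → Finset T) (c : S → T → ℝ) :
    IsCentredGaussianField μ (fun s ω => ∑ t ∈ F s, c s t * X t ω)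
      (fun s s' => ∑ t ∈ F s, ∑ t' ∈ F s', c s t * c s' t' * K t t') := by
  have := h.isProbabilityMeasure
  refine ⟨?_, fun s => ?_, fun s s' => ?_⟩
  · classical
    refine ⟨fun I => ?_⟩
    let L : (I.biUnion F → ℝ) →L[ℝ] I → ℝ := LinearMap.toContinuousLinearMap
      { toFun x s := ∑ t : F s, c s t * x ⟨t.1, Finset.mem_biUnion.2 ⟨s.1, s.2, t.2⟩⟩
        map_add' x y := by ext; simp [mul_add, Finset.sum_add_distrib]
        map_smul' a x := by ext; simp [Finset.mul_sum, mul_left_comm] }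
    have e : (fun ω => I.restrict fun s => ∑ t ∈ F s, c s t * X t ω) =
        L ∘ fun ω => (I.biUnion F).restrict (X · ω) := by
      ext ω s
      exact (Finset.sum_coe_sort (F s) fun t => c s t * X t ω).symm
    rw [e]
    exact (h.gaussian.hasGaussianLaw _).map L
  · rw [integral_finsetSum _ fun t _ => ((h.memLp t).integrable one_le_two).const_mul _]
    simp [integral_const_mul, h.centred]
  · rw [covariance_fun_sum_fun_sum' (fun t _ => (h.memLp t).const_mul _)
      (fun t _ => (h.memLp t).const_mul _)]
    refine Finset.sum_congr rfl fun t _ => Finset.sum_congr rfl fun t' _ => ?_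
    rw [covariance_const_mul_left, covariance_const_mul_right, h.cov, mul_assoc]

/-- An almost sure limit of centred Gaussian fields with converging covariances is a centred
Gaussian field: characteristic functions of linear combinations converge. -/
theorem of_tendsto [IsProbabilityMeasure μ] {Y : ℕ → T → Ω → ℝ} {L : ℕ → T → T → ℝ}
    (hY : ∀ n, IsCentredGaussianField μ (Y n) (L n))
    (hlim : ∀ t, ∀ᵐ ω ∂μ, Tendsto (fun n => Y n t ω) atTop (𝓝 (X t ω)))
    (hL : ∀ s t, Tendsto (fun n => L n s t) atTop (𝓝 (K s t))) :
    IsCentredGaussianField μ X K := by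
  have hX : ∀ t, AEMeasurable (X t) μ := fun t =>
    aemeasurable_of_tendsto_metrizable_ae atTop (fun n => (hY n).gaussian.aemeasurable t) (hlim t)
  have key : ∀ (F : Finset T) (c : T → ℝ), μ.map (fun ω => ∑ t ∈ F, c t * X t ω) =
      gaussianReal 0 (∑ t ∈ F, ∑ t' ∈ F, c t * c t' * K t t').toNNReal := by
    intro F c
    have hsum := fun n => (hY n).sum (fun _ : Unit => F) (fun _ => c)
    refine map_eq_gaussianReal_of_tendsto (fun n => (hsum n).gaussian.aemeasurable ())
      (Finset.aemeasurable_fun_sum F fun t _ => (hX t).const_mul _)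
      (fun n => (hsum n).map_eq ()) ?_ ?_
    · filter_upwards [(Finset.eventually_all F).2 fun t _ => hlim t] with ω hω
      exact tendsto_finsetSum _ fun t ht => (hω t ht).const_mul _
    · exact (continuous_real_toNNReal.tendsto _).comp
        (tendsto_finsetSum _ fun t _ => tendsto_finsetSum _ fun t' _ => (hL t t').const_mul _)
  have hgauss : IsGaussianProcess X μ := by
    refine ⟨fun I => ⟨isGaussian_of_map_eq_gaussianReal fun l => ?_⟩⟩
    classical
    have h1 := key I (fun t => if ht : t ∈ I then l (Pi.single ⟨t, ht⟩ 1) else 0)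
    have h2 : (fun ω => ∑ t ∈ I, (if ht : t ∈ I then l (Pi.single ⟨t, ht⟩ 1) else 0) * X t ω) =
        l ∘ fun ω => I.restrict (X · ω) := by
      ext ω
      rw [← Finset.sum_coe_sort I, Function.comp_apply,
        ← Finset.univ_sum_single (I.restrict (X · ω)), map_sum]
      refine Finset.sum_congr rfl fun t _ => ?_
      have : (Pi.single t (I.restrict (X · ω) t) : I → ℝ) = X t ω • Pi.single t 1 := by
        rw [← Pi.single_smul]; simp
      rw [this, map_smul]
      simp [mul_comm]
    have h3 : AEMeasurable (fun ω => I.restrict (X · ω)) μ :=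
      aemeasurable_pi_lambda _ fun t => hX t
    rw [h2, ← AEMeasurable.map_map_of_aemeasurable (by fun_prop) h3] at h1
    exact ⟨_, _, h1⟩
  have hlaw := fun t => hgauss.hasGaussianLaw_eval t
  have hcen : ∀ t, ∫ ω, X t ω ∂μ = 0 := fun t => by
    have h1 := key {t} (fun _ => 1)
    simp only [Finset.sum_singleton, one_mul] at h1
    have h2 := integral_map (μ := μ) (hX t) (f := fun x => x) (by fun_prop)
    rw [← h2, h1, integral_id_gaussianReal]
  have hvar : ∀ (F : Finset T) (c : T → ℝ), Var[fun ω => ∑ t ∈ F, c t * X t ω; μ] =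
      (∑ t ∈ F, ∑ t' ∈ F, c t * c t' * K t t').toNNReal := fun F c => by
    have h2 := variance_map (μ := μ) (X := fun x : ℝ => x)
      (Y := fun ω => ∑ t ∈ F, c t * X t ω) (by fun_prop)
      (Finset.aemeasurable_fun_sum F fun t _ => (hX t).const_mul _)
    rw [key, variance_fun_id_gaussianReal] at h2
    exact h2.symm
  have hpos : ∀ (F : Finset T) (c : T → ℝ), 0 ≤ ∑ t ∈ F, ∑ t' ∈ F, c t * c t' * K t t' :=
    fun F c => ge_of_tendsto (tendsto_finsetSum _ fun t _ => tendsto_finsetSum _ fun t' _ =>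
      (hL t t').const_mul _) (Eventually.of_forall fun n =>
        ((hY n).sum (fun _ : Unit => F) (fun _ => c)).cov_self_nonneg ())
  have hself : ∀ t, cov[X t, X t; μ] = K t t := fun t => by
    have h1 := hvar {t} (fun _ => 1)
    have h2 := hpos {t} (fun _ => 1)
    simp only [Finset.sum_singleton, one_mul] at h1 h2
    rw [covariance_self (hX t), h1, Real.coe_toNNReal _ h2]
  have hsymm : ∀ s t, K s t = K t s := fun s t => by
    refine tendsto_nhds_unique (hL s t) ((hL t s).congr fun n => ?_)
    rw [← (hY n).cov, ← (hY n).cov, covariance_comm]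
  refine ⟨hgauss, hcen, fun s t => ?_⟩
  by_cases hst : s = t
  · subst hst; exact hself s
  classical
  have h1 := hvar {s, t} (fun _ => 1)
  have h2 := hpos {s, t} (fun _ => 1)
  simp only [Finset.sum_pair hst, one_mul] at h1 h2
  rw [Real.coe_toNNReal _ h2, variance_fun_add (hlaw s).memLp_two (hlaw t).memLp_two,
    ← covariance_self (hX s), ← covariance_self (hX t), hself, hself, hsymm t s] at h1
  linarith

/-- If the layers `U (k, ·)` of a Gaussian field are uncorrelated and the variance of the `k`-th one
is geometrically small, then their sum over `k` converges absolutely. -/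
theorem ae_summable [Countable T] {U : ℕ × T → Ω → ℝ} {M : ℕ × T → ℕ × T → ℝ}
    (hU : IsCentredGaussianField μ U M) {q : ℝ} (hq0 : 0 < q) (hq1 : q < 1) (C : T → ℝ)
    (hM : ∀ k t, M (k, t) (k, t) ≤ C t * (q ^ k) ^ 2) :
    ∀ᵐ ω ∂μ, ∀ t, Summable fun k => U (k, t) ω := by
  have := hU.isProbabilityMeasure
  refine ae_all_iff.2 fun t => ?_
  have hint : ∀ k, Integrable (fun ω => U (k, t) ω) μ := fun k =>
    (hU.memLp (k, t)).integrable one_le_two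
  -- `|u| ≤ (s + u² / s) / 2` with `s = q ^ k` bounds the first moments.
  have hb : ∀ k, ∫ ω, ‖U (k, t) ω‖ ∂μ ≤ (1 + C t) / 2 * q ^ k := fun k => by
    have hs : 0 < q ^ k := pow_pos hq0 k
    calc ∫ ω, ‖U (k, t) ω‖ ∂μ ≤ ∫ ω, (q ^ k / 2 + (2 * q ^ k)⁻¹ * U (k, t) ω ^ 2) ∂μ := by
          refine integral_mono (hint k).norm
            ((integrable_const _).add ((hU.memLp (k, t)).integrable_sq.const_mul _)) fun ω => ?_
          have h0 : 0 ≤ (q ^ k - |U (k, t) ω|) ^ 2 * (2 * q ^ k)⁻¹ := by positivity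
          have h1 : (q ^ k - |U (k, t) ω|) ^ 2 * (2 * q ^ k)⁻¹ =
              q ^ k / 2 + (2 * q ^ k)⁻¹ * U (k, t) ω ^ 2 - |U (k, t) ω| := by
            rw [sub_sq, sq_abs]; field_simp; ring
          rw [Real.norm_eq_abs]
          linarith
      _ = q ^ k / 2 + (2 * q ^ k)⁻¹ * M (k, t) (k, t) := by
          rw [integral_add (integrable_const _) ((hU.memLp (k, t)).integrable_sq.const_mul _),
            integral_const_mul, hU.integral_sq]
          simp
      _ ≤ q ^ k / 2 + (2 * q ^ k)⁻¹ * (C t * (q ^ k) ^ 2) := by gcongr; exact hM k t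
      _ = (1 + C t) / 2 * q ^ k := by field_simp
  have hsum : Summable fun k => ∫ ω, ‖U (k, t) ω‖ ∂μ :=
    Summable.of_nonneg_of_le (fun k => integral_nonneg fun ω => norm_nonneg _) hb
      ((summable_geometric_of_lt_one hq0.le hq1).mul_left _)
  have hfin : ∫⁻ ω, ∑' k, ‖U (k, t) ω‖ₑ ∂μ ≠ ∞ := by
    rw [lintegral_tsum fun k => (hint k).aemeasurable.enorm]
    simp_rw [← fun k => ofReal_integral_norm_eq_lintegral_enorm (hint k)]
    exact hsum.tsum_ofReal_ne_top
  filter_upwards [ae_lt_top' (AEMeasurable.tsum fun k => (hint k).aemeasurable.enorm) hfin]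
    with ω hω
  exact Summable.of_nnnorm (ENNReal.tsum_coe_ne_top_iff_summable.1 hω.ne)

/-- The sum over `k` of the uncorrelated layers of a Gaussian field is again a Gaussian field, whose
covariance is the sum of the covariances of the layers. -/
theorem tsum {U : ℕ × T → Ω → ℝ} {M : ℕ → T → T → ℝ} {X : T → Ω → ℝ} {K : T → T → ℝ}
    (hU : IsCentredGaussianField μ U (fun p p' => if p.1 = p'.1 then M p.1 p.2 p'.2 else 0))
    (hX : ∀ t, ∀ᵐ ω ∂μ, HasSum (fun k => U (k, t) ω) (X t ω))
    (hK : ∀ s t, HasSum (fun k => M k s t) (K s t)) : IsCentredGaussianField μ X K := by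
  have := hU.isProbabilityMeasure
  have hpart := fun n : ℕ => hU.sum (S := T)
    (fun t => Finset.range n ×ˢ {t}) (fun _ _ => 1)
  refine of_tendsto hpart (fun t => ?_) (fun s t => ?_)
  · filter_upwards [hX t] with ω hω
    simpa [Finset.sum_product] using hω.tendsto_sum_nat
  · refine (hK s t).tendsto_sum_nat.congr fun n => ?_
    simp only [one_mul, Finset.sum_product, Finset.sum_singleton]
    refine Finset.sum_congr rfl fun k hk => ?_
    rw [Finset.sum_ite_eq, if_pos hk]

/-- Two-sided Gaussian tail bound. -/
theorem measure_abs_gt_le (h : IsCentredGaussianField μ X K) (t : T) {v : ℝ} (hv : K t t ≤ v)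
    (hv0 : 0 < v) {ε : ℝ} (hε : 0 ≤ ε) :
    μ.real {ω | ε < |X t ω|} ≤ 2 * Real.exp (-ε ^ 2 / (2 * v)) := by
  have := h.isProbabilityMeasure
  have hsub : ∀ {Y : Ω → ℝ}, AEMeasurable Y μ → μ.map Y = gaussianReal 0 (K t t).toNNReal →
      μ.real {ω | ε ≤ Y ω} ≤ Real.exp (-ε ^ 2 / (2 * v)) := fun {Y} hY hlaw => by
    have : HasSubgaussianMGF Y v.toNNReal μ := by
      refine ⟨fun s => ?_, fun s => ?_⟩
      · have := integrable_exp_mul_gaussianReal (μ := 0) (v := (K t t).toNNReal) s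
        rw [← hlaw] at this
        exact (integrable_map_measure (by fun_prop) hY).1 this
      · rw [mgf_gaussianReal hlaw]
        refine Real.exp_le_exp.2 ?_
        rw [Real.coe_toNNReal _ (h.cov_self_nonneg t), Real.coe_toNNReal _ hv0.le]
        have := mul_le_mul_of_nonneg_right hv (sq_nonneg s)
        linarith
    have h2 := this.measure_ge_le hε
    rwa [Real.coe_toNNReal _ hv0.le] at h2
  have hX := h.gaussian.aemeasurable t
  have hneg : μ.map (fun ω => -X t ω) = gaussianReal 0 (K t t).toNNReal := by
    have := AEMeasurable.map_map_of_aemeasurable (μ := μ) (g := fun x : ℝ => -x) (by fun_prop) hX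
    rw [h.map_eq, gaussianReal_map_neg, neg_zero] at this
    exact this.symm
  calc μ.real {ω | ε < |X t ω|} ≤ μ.real ({ω | ε ≤ X t ω} ∪ {ω | ε ≤ -X t ω}) := by
        refine measureReal_mono fun ω hω => ?_
        rcases lt_abs.1 (Set.mem_ofPred.1 hω) with h | h
        exacts [Or.inl h.le, Or.inr h.le]
    _ ≤ _ := (measureReal_union_le _ _).trans
        ((add_le_add (hsub hX (h.map_eq t)) (hsub hX.neg hneg)).trans_eq (two_mul _).symm)

end IsCentredGaussianField

/-- Independent centred Gaussian variables form a centred Gaussian field. -/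
theorem isCentredGaussianField_of_iIndepFun {X : T → Ω → ℝ} (hind : iIndepFun X μ) {v : T → ℝ≥0}
    (hlaw : ∀ t, HasLaw (X t) (gaussianReal 0 (v t)) μ) [DecidableEq T] :
    IsCentredGaussianField μ X (fun s t => if s = t then (v s : ℝ) else 0) := by
  have hG : ∀ t, HasGaussianLaw (X t) μ := fun t => (hlaw t).hasGaussianLaw
  refine ⟨⟨fun I => ?_⟩, fun t => ?_, fun s t => ?_⟩
  · exact (hind.precomp Subtype.val_injective).hasGaussianLaw fun t : I => hG t
  · rw [(hlaw t).integral_eq, integral_id_gaussianReal]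
  · split_ifs with hst
    · subst hst
      rw [covariance_self (hG s).aemeasurable, (hlaw s).variance_eq, variance_id_gaussianReal]
    · exact (hind.indepFun hst).covariance_eq_zero (hG s).memLp_two (hG t).memLp_two

end Gaussian

/-! ### Random walk operators and subdivided graphs -/

section Operators

variable {V : Type*} {H : SimpleGraph V}

theorem finite_neighborSet {x : V} (h : deg H x ≠ 0) : (H.neighborSet x).Finite :=
  Set.finite_of_ncard_ne_zero h

theorem srwOp_eq_sum {x : V} (h : deg H x ≠ 0) (f : V → ℝ) :
    srwOp H f x = (∑ y ∈ (finite_neighborSet h).toFinset, f y) / (deg H x : ℝ) := by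
  rw [srwOp, finsum_mem_eq_finite_toFinset_sum]

theorem card_neighbors {x : V} (h : deg H x ≠ 0) :
    (finite_neighborSet h).toFinset.card = deg H x :=
  (Set.ncard_eq_toFinset_card _ _).symm

theorem srwOp_congr {x : V} {f g : V → ℝ} (h : ∀ y, H.Adj x y → f y = g y) :
    srwOp H f x = srwOp H g x := by
  rw [srwOp, srwOp, finsum_mem_congr (s := H.neighborSet x) rfl fun y hy => h y hy]

theorem pointInd_apply [DecidableEq V] (y z : V) :
    pointInd y z = if z = y then (1 : ℝ) else 0 := by
  by_cases h : z = y <;> simp [pointInd, h]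

theorem srwProb_succ {x : V} (h : deg H x ≠ 0) (k : ℕ) (z : V) :
    srwProb H (k + 1) x z =
      (∑ y ∈ (finite_neighborSet h).toFinset, srwProb H k y z) / (deg H x : ℝ) := by
  rw [srwProb, Function.iterate_succ_apply', srwOp_eq_sum h]
  rfl

/-- The kernel of `Q ^ k` has finitely supported rows. -/
theorem exists_srwOp_iterate_eq_sum (hH : ∀ x, deg H x ≠ 0) (k : ℕ) (x : V) :
    ∃ s : Finset V, (∀ z ∉ s, srwProb H k x z = 0) ∧
      ∀ f : V → ℝ, (srwOp H)^[k] f x = ∑ z ∈ s, srwProb H k x z * f z := by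
  classical
  induction k generalizing x with
  | zero =>
    refine ⟨{x}, fun z hz => ?_, fun f => ?_⟩
    · simp only [Finset.mem_singleton] at hz
      simp [srwProb, pointInd_apply, Ne.symm hz]
    · simp [srwProb, pointInd_apply]
  | succ k ih =>
    choose s hs hsf using ih
    refine ⟨(finite_neighborSet (hH x)).toFinset.biUnion s, fun z hz => ?_, fun f => ?_⟩
    · rw [srwProb_succ (hH x), Finset.sum_eq_zero, zero_div]
      exact fun y hy => hs y z fun h => hz (Finset.mem_biUnion.2 ⟨y, hy, h⟩)
    · rw [Function.iterate_succ_apply', srwOp_eq_sum (hH x)]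
      simp_rw [fun z => srwProb_succ (hH x) k z, div_mul_eq_mul_div, Finset.sum_mul]
      rw [← Finset.sum_div, Finset.sum_comm]
      congr 1
      refine Finset.sum_congr rfl fun y hy => ?_
      rw [hsf]
      refine Finset.sum_subset (Finset.subset_biUnion_of_mem s hy) fun z _ hz => ?_
      rw [hs y z hz, zero_mul]

/-- The walk is reversible with respect to the degrees. -/
theorem deg_mul_srwProb_comm (hH : ∀ x, deg H x ≠ 0) (k : ℕ) (x y : V) :
    (deg H x : ℝ) * srwProb H k x y = deg H y * srwProb H k y x := by
  classical
  have hH' : ∀ x, (deg H x : ℝ) ≠ 0 := fun x => Nat.cast_ne_zero.2 (hH x)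
  induction k generalizing x y with
  | zero =>
    by_cases h : x = y
    · rw [h]
    · simp [srwProb, pointInd_apply, h, Ne.symm h]
  | succ k ih =>
    obtain ⟨s, hs, hsf⟩ := exists_srwOp_iterate_eq_sum hH k y
    have h1 : srwProb H (k + 1) y x =
        ∑ z ∈ s ∪ (finite_neighborSet (hH x)).toFinset,
          srwProb H k y z * srwOp H (pointInd x) z := by
      rw [srwProb, Function.iterate_succ_apply, hsf]
      exact Finset.sum_subset Finset.subset_union_left fun z _ hz => by rw [hs z hz, zero_mul]
    have h2 : ∀ z, srwOp H (pointInd x) z =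
        if z ∈ (finite_neighborSet (hH x)).toFinset then (1 : ℝ) / deg H z else 0 := fun z => by
      rw [srwOp_eq_sum (hH z)]
      simp only [pointInd_apply, Finset.sum_ite_eq', Set.Finite.mem_toFinset,
        SimpleGraph.mem_neighborSet, H.adj_comm z x]
      split_ifs <;> simp
    rw [h1, srwProb_succ (hH x), mul_div_cancel₀ _ (hH' x), Finset.mul_sum]
    simp_rw [h2, mul_ite, mul_zero]
    rw [← Finset.sum_filter, Finset.filter_mem_eq_inter, Finset.inter_eq_right.2
      Finset.subset_union_right]
    refine Finset.sum_congr rfl fun z _ => ?_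
    have := ih z y
    have hz := hH' z
    field_simp
    linarith

theorem sum_srwProb_mul_srwProb {k : ℕ} {x : V} {s : Finset V}
    (hs : ∀ f : V → ℝ, (srwOp H)^[k] f x = ∑ z ∈ s, srwProb H k x z * f z) (y : V) :
    ∑ z ∈ s, srwProb H k x z * srwProb H k z y = srwProb H (2 * k) x y := by
  rw [srwProb, two_mul, Function.iterate_add_apply, hs]
  rfl

theorem srwOp_const {x : V} (h : deg H x ≠ 0) (c : ℝ) :
    srwOp H (fun _ => c) x = c := by
  rw [srwOp_eq_sum h, Finset.sum_const, card_neighbors h, nsmul_eq_mul,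
    mul_div_cancel_left₀ _ (Nat.cast_ne_zero.2 h)]

end Operators

section Subdivision

variable {V : Type*} {G : SimpleGraph V}

theorem neighborSet_subdiv_inl (x : V) : (subdiv G).neighborSet (Sum.inl x) =
    Set.range fun u : G.neighborSet x => (Sum.inr ⟨s(x, u.1), G.mem_edgeSet.2 u.2⟩ : SubdivVertex G) := by
  ext z
  simp only [SimpleGraph.mem_neighborSet, subdiv, Set.mem_range]
  constructor
  · rintro (⟨y, e, h1, rfl, h3⟩ | ⟨y, e, -, h2, -⟩)
    · cases h1
      obtain ⟨u, hu⟩ := Sym2.mem_iff_exists.1 h3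
      refine ⟨⟨u, ?_⟩, ?_⟩
      · have := e.2
        rwa [hu] at this
      · congr 1
        exact Subtype.ext hu.symm
    · cases h2
  · rintro ⟨u, rfl⟩
    exact Or.inl ⟨x, _, rfl, rfl, Sym2.mem_mk_left _ _⟩

theorem injective_neighbor_edge (x : V) : Function.Injective
    fun u : G.neighborSet x => (Sum.inr ⟨s(x, u.1), G.mem_edgeSet.2 u.2⟩ : SubdivVertex G) := by
  intro u v h
  have h1 := congrArg Subtype.val (Sum.inr.inj h)
  exact Subtype.ext (Sym2.congr_right.1 h1)

theorem deg_subdiv_inl (x : V) : deg (subdiv G) (Sum.inl x) = deg G x := by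
  rw [deg, neighborSet_subdiv_inl, ← Set.image_univ,
    Set.ncard_image_of_injective _ (injective_neighbor_edge x), Set.ncard_univ]
  rfl

theorem neighborSet_subdiv_inr (u v : V) (h : s(u, v) ∈ G.edgeSet) :
    (subdiv G).neighborSet (Sum.inr ⟨s(u, v), h⟩) = {Sum.inl u, Sum.inl v} := by
  ext z
  simp only [SimpleGraph.mem_neighborSet, subdiv, Set.mem_insert_iff, Set.mem_singleton_iff]
  constructor
  · rintro (⟨y, e, h1, -⟩ | ⟨y, e, rfl, h2, h3⟩)
    · cases h1
    · cases h2
      rcases Sym2.mem_iff.1 h3 with rfl | rfl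
      exacts [Or.inl rfl, Or.inr rfl]
  · rintro (rfl | rfl)
    exacts [Or.inr ⟨_, _, rfl, rfl, Sym2.mem_mk_left _ _⟩,
      Or.inr ⟨_, _, rfl, rfl, Sym2.mem_mk_right _ _⟩]

theorem deg_subdiv_inr (e : G.edgeSet) : deg (subdiv G) (Sum.inr e) = 2 := by
  obtain ⟨e, he⟩ := e
  induction e with | _ u v =>
  rw [deg, neighborSet_subdiv_inr, Set.ncard_pair]
  exact fun h => G.ne_of_adj he (Sum.inl.inj h)

theorem deg_subdiv_ne_zero (hG : ∀ x, deg G x ≠ 0) (z : SubdivVertex G) :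
    deg (subdiv G) z ≠ 0 := by
  rcases z with x | e
  · rw [deg_subdiv_inl]; exact hG x
  · rw [deg_subdiv_inr]; exact two_ne_zero

/-- The values of `f` at the midpoints of edges, extended by zero to all unordered pairs. -/
def edgeFn (f : SubdivVertex G → ℝ) (e : Sym2 V) : ℝ :=
  open Classical in if h : e ∈ G.edgeSet then f (Sum.inr ⟨e, h⟩) else 0

theorem edgeFn_of_adj (f : SubdivVertex G → ℝ) {x u : V} (h : G.Adj x u) :
    edgeFn f s(x, u) = f (Sum.inr ⟨s(x, u), G.mem_edgeSet.2 h⟩) := by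
  rw [edgeFn, dif_pos (G.mem_edgeSet.2 h)]

theorem srwOp_subdiv_inl (f : SubdivVertex G → ℝ) (x : V) :
    srwOp (subdiv G) f (Sum.inl x) = srwOp G (fun u => edgeFn f s(x, u)) x := by
  rw [srwOp, srwOp, deg_subdiv_inl, neighborSet_subdiv_inl,
    finsum_mem_range (injective_neighbor_edge x), ← finsum_set_coe_eq_finsum_mem]
  congr 1
  exact finsum_congr fun u => (edgeFn_of_adj f u.2).symm

theorem srwOp_subdiv_inr (f : SubdivVertex G → ℝ) {u v : V} (h : s(u, v) ∈ G.edgeSet) :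
    srwOp (subdiv G) f (Sum.inr ⟨s(u, v), h⟩) = (f (Sum.inl u) + f (Sum.inl v)) / 2 := by
  rw [srwOp, deg_subdiv_inr, neighborSet_subdiv_inr, finsum_mem_pair, Nat.cast_ofNat]
  exact fun h' => G.ne_of_adj (G.mem_edgeSet.1 h) (Sum.inl.inj h')

/-- Two steps of the walk on the subdivided graph are one step of the lazy walk. -/
theorem srwOp_subdiv_two (hG : ∀ x, deg G x ≠ 0) (f : SubdivVertex G → ℝ) :
    ((srwOp (subdiv G))^[2] f) ∘ Sum.inl = lazyOp G (f ∘ Sum.inl) := by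
  ext x
  have hx : (deg G x : ℝ) ≠ 0 := Nat.cast_ne_zero.2 (hG x)
  have h1 : srwOp (subdiv G) (srwOp (subdiv G) f) (Sum.inl x) =
      srwOp G (fun u => (f (Sum.inl x) + f (Sum.inl u)) / 2) x := by
    rw [srwOp_subdiv_inl]
    exact srwOp_congr fun u hu => by rw [edgeFn_of_adj _ hu, srwOp_subdiv_inr]
  change srwOp (subdiv G) (srwOp (subdiv G) f) (Sum.inl x) = _
  rw [h1, lazyOp, srwOp_eq_sum (hG x), srwOp_eq_sum (hG x), ← Finset.sum_div,
    Finset.sum_add_distrib, Finset.sum_const, card_neighbors (hG x), nsmul_eq_mul]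
  simp only [Function.comp_apply]
  field_simp

theorem srwOp_subdiv_iterate_two_mul (hG : ∀ x, deg G x ≠ 0) (k : ℕ) (f : SubdivVertex G → ℝ) :
    ((srwOp (subdiv G))^[2 * k] f) ∘ Sum.inl = (lazyOp G)^[k] (f ∘ Sum.inl) := by
  have : Function.Semiconj (fun f : SubdivVertex G → ℝ => f ∘ Sum.inl) (srwOp (subdiv G))^[2]
      (lazyOp G) := srwOp_subdiv_two hG
  rw [Function.iterate_mul]
  exact this.iterate_right k f

theorem srwOp_subdiv_iterate_two_mul_apply (hG : ∀ x, deg G x ≠ 0) (k : ℕ)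
    (f : SubdivVertex G → ℝ) (x : V) :
    (srwOp (subdiv G))^[2 * k] f (Sum.inl x) = (lazyOp G)^[k] (f ∘ Sum.inl) x :=
  congrFun (srwOp_subdiv_iterate_two_mul hG k f) x

theorem srwProb_subdiv (hG : ∀ x, deg G x ≠ 0) (k : ℕ) (x y : V) :
    srwProb (subdiv G) (2 * k) (Sum.inl x) (Sum.inl y) = lazyProb G k x y := by
  classical
  have h : (pointInd (Sum.inl y) : SubdivVertex G → ℝ) ∘ Sum.inl = pointInd y := by
    ext z; simp [pointInd_apply]
  rw [lazyProb, ← h, ← srwOp_subdiv_iterate_two_mul hG]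
  rfl

theorem lazyProb_comm {d : ℕ} (hd : d ≠ 0) (hG : ∀ x, deg G x = d) (k : ℕ) (x y : V) :
    lazyProb G k x y = lazyProb G k y x := by
  have hG' : ∀ x, deg G x ≠ 0 := fun x => by rwa [hG]
  have := deg_mul_srwProb_comm (deg_subdiv_ne_zero hG') (2 * k) (Sum.inl x) (Sum.inl y)
  rw [deg_subdiv_inl, deg_subdiv_inl, hG, hG, srwProb_subdiv hG', srwProb_subdiv hG'] at this
  exact mul_left_cancel₀ (Nat.cast_ne_zero.2 hd) this

variable {Ω : Type*} [MeasurableSpace Ω] {μ : Measure Ω}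

/-- The fields `Q ^ k Z_k` are independent for different `k`, and by reversibility the covariance
of the `k`-th one is half of the transition function of the lazy walk. -/
theorem IsNoise.isCentredGaussianField_zeta {d : ℕ} (hd : d ≠ 0) (hG : ∀ x, deg G x = d)
    {Z : ℕ → SubdivVertex G → Ω → ℝ} (hZ : IsNoise μ G ((d : ℝ) / 2) Z) :
    IsCentredGaussianField μ (fun (p : ℕ × V) ω => zeta G p.1 (fun z => Z p.1 z ω) p.2)
      (fun p p' => if p.1 = p'.1 then lazyProb G p.1 p.2 p'.2 / 2 else 0) := by
  classical
  have hG' : ∀ x, deg G x ≠ 0 := fun x => by rwa [hG]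
  have hS := deg_subdiv_ne_zero hG'
  choose s hs hsf using exists_srwOp_iterate_eq_sum hS
  have h0 := (isCentredGaussianField_of_iIndepFun hZ.indep fun p => hZ.law p.1 p.2).sum
    (fun p : ℕ × V => {p.1} ×ˢ s p.1 (Sum.inl p.2))
    (fun p t => srwProb (subdiv G) p.1 (Sum.inl p.2) t.2)
  convert h0 using 1
  · ext p ω
    rw [zeta, hsf, Finset.sum_product, Finset.sum_singleton]
  · ext ⟨k, x⟩ ⟨l, y⟩
    simp only [Finset.sum_product, Finset.sum_singleton, Prod.mk.injEq]
    split_ifs with hkl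
    · subst hkl
      simp only [true_and, mul_ite, mul_zero, Finset.sum_ite_eq]
      rw [← srwProb_subdiv hG', ← sum_srwProb_mul_srwProb (hsf k (Sum.inl x)), Finset.sum_div]
      refine Finset.sum_congr rfl fun z _ => ?_
      have hz : (deg (subdiv G) z : ℝ) ≠ 0 := Nat.cast_ne_zero.2 (hS z)
      have hd' : (d : ℝ) ≠ 0 := Nat.cast_ne_zero.2 hd
      have hrev := deg_mul_srwProb_comm hS k z (Sum.inl y)
      rw [deg_subdiv_inl, hG] at hrev
      split_ifs with hmem
      · rw [Real.coe_toNNReal _ (by positivity)]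
        field_simp
        linear_combination srwProb (subdiv G) k (Sum.inl x) z * hrev
      · rw [hs k (Sum.inl y) z hmem, mul_zero] at hrev
        rw [(mul_eq_zero.1 hrev).resolve_left hz, mul_zero, zero_div]
    · simp [hkl]

end Subdivision

/-! ### Walks with a strictly superharmonic weight -/

section Weight

open Topology

variable {V : Type*} {H : SimpleGraph V} {h : V → ℝ} {ρ : ℝ}

theorem srwOp_sub_mul (hH : ∀ x, deg H x ≠ 0) (f g : V → ℝ) (c : ℝ) (x : V) :
    srwOp H (fun z => f z - g z * c) x = srwOp H f x - srwOp H g x * c := by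
  simp_rw [srwOp_eq_sum (hH x), Finset.sum_sub_distrib, ← Finset.sum_mul]
  ring

theorem abs_srwOp_le (hH : ∀ x, deg H x ≠ 0) (hρ : ∀ x, srwOp H h x ≤ ρ * h x) {f : V → ℝ} {C : ℝ}
    (hC : 0 ≤ C) (hf : ∀ x, |f x| ≤ C * h x) (x : V) : |srwOp H f x| ≤ C * ρ * h x := by
  have hd : (0 : ℝ) < deg H x := Nat.cast_pos.2 (Nat.pos_of_ne_zero (hH x))
  have h1 := mul_le_mul_of_nonneg_left (hρ x) hC
  rw [srwOp_eq_sum (hH x)] at h1 ⊢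
  rw [abs_div, abs_of_pos hd]
  calc _ ≤ (∑ y ∈ (finite_neighborSet (hH x)).toFinset, C * h y) / (deg H x : ℝ) := by
        gcongr
        exact (Finset.abs_sum_le_sum_abs _ _).trans (Finset.sum_le_sum fun y _ => hf y)
    _ ≤ _ := by rw [← Finset.mul_sum, mul_div_assoc, mul_assoc]; exact h1

theorem abs_lazyOp_le (hH : ∀ x, deg H x ≠ 0) (hρ : ∀ x, srwOp H h x ≤ ρ * h x) {f : V → ℝ} {C : ℝ}
    (hC : 0 ≤ C) (hf : ∀ x, |f x| ≤ C * h x) (x : V) :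
    |lazyOp H f x| ≤ C * ((1 + ρ) / 2) * h x := by
  have h1 := abs_srwOp_le hH hρ hC hf x
  have h2 := hf x
  rw [lazyOp]
  rw [abs_le] at h1 h2 ⊢
  constructor <;> linarith [h1.1, h1.2, h2.1, h2.2]

theorem abs_iterate_le {A : (V → ℝ) → V → ℝ} (hρ0 : 0 ≤ ρ)
    (hA : ∀ (f : V → ℝ) (C : ℝ), 0 ≤ C → (∀ x, |f x| ≤ C * h x) → ∀ x, |A f x| ≤ C * ρ * h x)
    {f : V → ℝ} {C : ℝ} (hC : 0 ≤ C) (hf : ∀ x, |f x| ≤ C * h x) (k : ℕ) (x : V) :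
    |A^[k] f x| ≤ C * ρ ^ k * h x := by
  induction k generalizing x with
  | zero => simpa using hf x
  | succ k ih =>
    rw [Function.iterate_succ_apply', pow_succ, ← mul_assoc]
    exact hA _ _ (by positivity) ih x

theorem abs_pointInd_le (hh : ∀ x, 0 < h x) (x y : V) : |pointInd y x| ≤ (h y)⁻¹ * h x := by
  classical
  rw [pointInd_apply]
  split_ifs with hxy
  · subst hxy; simp [(hh x).ne']
  · simpa using mul_nonneg (inv_nonneg.2 (hh y).le) (hh x).le

theorem abs_lazyProb_le (hH : ∀ x, deg H x ≠ 0) (hh : ∀ x, 0 < h x)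
    (hρ : ∀ x, srwOp H h x ≤ ρ * h x) (hρ0 : 0 ≤ ρ) (k : ℕ) (x y : V) :
    |lazyProb H k x y| ≤ (h y)⁻¹ * ((1 + ρ) / 2) ^ k * h x :=
  abs_iterate_le (by positivity) (fun _ _ => abs_lazyOp_le hH hρ) (inv_nonneg.2 (hh y).le)
    (fun x => abs_pointInd_le hh x y) k x

theorem abs_srwProb_le (hH : ∀ x, deg H x ≠ 0) (hh : ∀ x, 0 < h x)
    (hρ : ∀ x, srwOp H h x ≤ ρ * h x) (hρ0 : 0 ≤ ρ) (k : ℕ) (x y : V) :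
    |srwProb H k x y| ≤ (h y)⁻¹ * ρ ^ k * h x :=
  abs_iterate_le hρ0 (fun _ _ => abs_srwOp_le hH hρ) (inv_nonneg.2 (hh y).le)
    (fun x => abs_pointInd_le hh x y) k x

theorem summable_of_abs_le_geometric {a : ℕ → ℝ} {C q b : ℝ} (hq0 : 0 ≤ q) (hq1 : q < 1)
    (ha : ∀ k, |a k| ≤ C * q ^ k * b) : Summable a ∧ |∑' k, a k| ≤ C * (1 - q)⁻¹ * b := by
  have hs : HasSum (fun k => C * q ^ k * b) (C * (1 - q)⁻¹ * b) :=
    ((hasSum_geometric_of_lt_one hq0 hq1).mul_left C).mul_right b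
  refine ⟨hs.summable.of_norm_bounded ha, ?_⟩
  rw [← Real.norm_eq_abs]
  exact tsum_of_norm_bounded hs ha

/-- The Green function of the simple random walk is half of the Green function of the lazy walk:
both `g` and `u / 2` solve `g = 1_y + Q g`, and a `Q`-harmonic function bounded by a multiple of a
weight `h` with `Q h ≤ ρ h`, `ρ < 1`, vanishes. -/
theorem hasSum_lazyProb_div_two (hH : ∀ x, deg H x ≠ 0) (hh : ∀ x, 0 < h x)
    (hρ : ∀ x, srwOp H h x ≤ ρ * h x) (hρ0 : 0 ≤ ρ) (hρ1 : ρ < 1) (x y : V) :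
    HasSum (fun k => lazyProb H k x y / 2) (green H x y) := by
  have hP := fun x => summable_of_abs_le_geometric hρ0 hρ1
    fun k => abs_srwProb_le hH hh hρ hρ0 k x y
  have hL := fun x => summable_of_abs_le_geometric (by positivity) (by linarith)
    fun k => abs_lazyProb_le hH hh hρ hρ0 k x y
  set g : V → ℝ := fun x => ∑' k, srwProb H k x y with hg
  set u : V → ℝ := fun x => ∑' k, lazyProb H k x y with hu
  have htsum : ∀ (a : ℕ → V → ℝ), (∀ x, Summable fun k => a k x) → ∀ x,
      HasSum (fun k => srwOp H (a k) x) (srwOp H (fun z => ∑' k, a k z) x) := fun a ha x => by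
    simp_rw [srwOp_eq_sum (hH x)]
    exact (hasSum_sum fun z _ => (ha z).hasSum).div_const _
  have eg : ∀ x, g x = pointInd y x + srwOp H g x := fun x => by
    simp only [hg]
    rw [(hP x).1.tsum_eq_zero_add, ← (htsum _ (fun x => (hP x).1) x).tsum_eq]
    congr 1
    exact tsum_congr fun k => by rw [srwProb, Function.iterate_succ_apply']; rfl
  have eu : ∀ x, u x = pointInd y x + (u x / 2 + srwOp H u x / 2) := fun x => by
    have h1 := ((hL x).1.hasSum.div_const 2).add ((htsum _ (fun x => (hL x).1) x).div_const 2)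
    simp only [hu]
    rw [← h1.tsum_eq]
    rw [(hL x).1.tsum_eq_zero_add]
    congr 1
    exact tsum_congr fun k => by rw [lazyProb, Function.iterate_succ_apply']; rfl
  set e : V → ℝ := fun x => g x - u x * (1 / 2) with he
  have ee : srwOp H e = e := by
    ext x
    rw [he, srwOp_sub_mul hH]
    linarith [eg x, eu x]
  have hC0 : 0 ≤ (h y)⁻¹ * (1 - ρ)⁻¹ + (h y)⁻¹ * (1 - (1 + ρ) / 2)⁻¹ := by
    have h1 := hh y
    have h2 : 0 < 1 - ρ := by linarith
    have h3 : 0 < 1 - (1 + ρ) / 2 := by linarith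
    positivity
  have hbound : ∀ x, |e x| ≤ ((h y)⁻¹ * (1 - ρ)⁻¹ + (h y)⁻¹ * (1 - (1 + ρ) / 2)⁻¹) * h x :=
      fun x => by
    have h1 : |g x| ≤ _ := (hP x).2
    have h2 : |u x| ≤ _ := (hL x).2
    rw [add_mul]
    refine (abs_sub _ _).trans (add_le_add h1 ?_)
    rw [abs_mul]
    norm_num
    linarith [abs_nonneg (u x), h2]
  have hzero : e x = 0 := by
    have h1 : ∀ k, |e x| ≤ ((h y)⁻¹ * (1 - ρ)⁻¹ + (h y)⁻¹ * (1 - (1 + ρ) / 2)⁻¹) * ρ ^ k * h x :=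
        fun k => by
      have := abs_iterate_le hρ0 (fun _ _ => abs_srwOp_le hH hρ) hC0 hbound k x
      rwa [Function.iterate_fixed ee] at this
    have h2 := ((tendsto_pow_atTop_nhds_zero_of_lt_one hρ0 hρ1).const_mul
      ((h y)⁻¹ * (1 - ρ)⁻¹ + (h y)⁻¹ * (1 - (1 + ρ) / 2)⁻¹)).mul_const (h x)
    rw [mul_zero, zero_mul] at h2
    exact abs_nonpos_iff.1 (ge_of_tendsto h2 (Eventually.of_forall h1))
  have : green H x y = u x / 2 := by
    have h1 : g x - u x * (1 / 2) = 0 := hzero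
    change g x = _
    linarith
  rw [this]
  exact (hL x).1.hasSum.div_const 2

end Weight

/-! ### The regular tree -/

section Tree

variable {d : ℕ}

instance : Countable (TreeVertex d) := inferInstanceAs (Countable (Subtype _))

/-- The vertex of the tree given by a word. -/
def treeWord (w : List (Fin d)) (h : w.IsChain (fun a b => a ≠ b)) : TreeVertex d := ⟨w, h⟩

theorem treeWord_inj {w w' : List (Fin d)} {h h'} (e : treeWord w h = treeWord w' h') : w = w' :=
  congrArg Subtype.val e

theorem treeVertex_eq (v : TreeVertex d) {w : List (Fin d)} (h : v.1 = w) :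
    v = treeWord w (h ▸ v.2) := Subtype.ext h

/-- A vertex of the tree obtained from a word with head `b` by adding a letter. -/
def treeChild (b : Fin d) (l : List (Fin d)) (h : (b :: l).IsChain (fun a b => a ≠ b))
    (a : {a : Fin d // a ≠ b}) : TreeVertex d :=
  treeWord (a :: b :: l) (List.isChain_cons_cons.2 ⟨a.2, h⟩)

theorem neighborSet_tree_nil (h) : (tree d).neighborSet (treeWord [] h) =
    Set.range fun a : Fin d => treeWord [a] (List.isChain_singleton a) := by
  ext v
  constructor
  · rintro (⟨a, h⟩ | ⟨a, h⟩)
    · cases h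
    · exact ⟨a, (treeVertex_eq v h).symm⟩
  · rintro ⟨a, rfl⟩
    exact Or.inr ⟨a, rfl⟩

theorem neighborSet_tree_cons (b : Fin d) (l : List (Fin d)) (h) :
    (tree d).neighborSet (treeWord (b :: l) h) =
      insert (treeWord l h.of_cons) (Set.range (treeChild b l h)) := by
  ext v
  constructor
  · rintro (⟨a, h'⟩ | ⟨a, h'⟩)
    · exact Or.inl (treeVertex_eq v (List.cons.inj h').2.symm)
    · have := v.2
      rw [h'] at this
      exact Or.inr ⟨⟨a, (List.isChain_cons_cons.1 this).1⟩, (treeVertex_eq v h').symm⟩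
  · rintro (rfl | ⟨a, rfl⟩)
    · exact Or.inl ⟨b, rfl⟩
    · exact Or.inr ⟨a, rfl⟩

theorem injective_treeWord_singleton :
    Function.Injective fun a : Fin d => treeWord [a] (List.isChain_singleton a) :=
  fun _ _ h => List.singleton_injective (treeWord_inj h)

theorem injective_treeChild (b : Fin d) (l : List (Fin d)) (h) :
    Function.Injective (treeChild b l h) :=
  fun _ _ haa => Subtype.ext (List.cons.inj (treeWord_inj haa)).1

theorem parent_notMem_children (b : Fin d) (l : List (Fin d)) (h) :
    treeWord l h.of_cons ∉ Set.range (treeChild b l h) := by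
  rintro ⟨a, ha⟩
  have := congrArg List.length (treeWord_inj ha)
  simp only [List.length_cons] at this
  omega

theorem treeVertex_cases (v : TreeVertex d) :
    (∃ h, v = treeWord [] h) ∨ ∃ b l h, v = treeWord (b :: l) h := by
  obtain ⟨w, hw⟩ := v
  cases w with
  | nil => exact Or.inl ⟨hw, rfl⟩
  | cons b l => exact Or.inr ⟨b, l, hw, rfl⟩

theorem deg_tree (hd : d ≠ 0) (v : TreeVertex d) : deg (tree d) v = d := by
  rcases treeVertex_cases v with ⟨hw, rfl⟩ | ⟨b, l, hw, rfl⟩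
  · rw [deg, neighborSet_tree_nil, ← Set.image_univ,
      Set.ncard_image_of_injective _ injective_treeWord_singleton, Set.ncard_univ]
    simp
  · rw [deg, neighborSet_tree_cons, Set.ncard_insert_of_notMem (parent_notMem_children b l hw),
      ← Set.image_univ, Set.ncard_image_of_injective _ (injective_treeChild b l hw),
      Set.ncard_univ, Nat.card_eq_fintype_card, Fintype.card_subtype_compl]
    simp
    omega

/-- The weight `(d - 1) ^ (-|v| / 2)` on the tree. -/
def treeWeight (d : ℕ) (v : TreeVertex d) : ℝ := (√((d : ℝ) - 1))⁻¹ ^ v.1.length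

/-- The spectral radius `2 √(d - 1) / d` of the simple random walk on the `d`-regular tree. -/
def treeRadius (d : ℕ) : ℝ := 2 * √((d : ℝ) - 1) / d

theorem treeRadius_pos (hd : 3 ≤ d) : 0 < treeRadius d := by
  have h : (3 : ℝ) ≤ d := by exact_mod_cast hd
  have : 0 < √((d : ℝ) - 1) := Real.sqrt_pos.2 (by linarith)
  rw [treeRadius]
  positivity

theorem treeRadius_lt_one (hd : 3 ≤ d) : treeRadius d < 1 := by
  have h : (3 : ℝ) ≤ d := by exact_mod_cast hd
  rw [treeRadius, div_lt_one (by linarith)]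
  have h2 : √((d : ℝ) - 1) < d / 2 := by
    rw [Real.sqrt_lt' (by linarith)]
    nlinarith
  linarith

theorem treeWeight_pos (hd : 3 ≤ d) (v : TreeVertex d) : 0 < treeWeight d v := by
  have h : (3 : ℝ) ≤ d := by exact_mod_cast hd
  have : 0 < √((d : ℝ) - 1) := Real.sqrt_pos.2 (by linarith)
  rw [treeWeight]
  positivity

theorem srwOp_treeWeight_le (hd : 3 ≤ d) (v : TreeVertex d) :
    srwOp (tree d) (treeWeight d) v ≤ treeRadius d * treeWeight d v := by
  have h : (3 : ℝ) ≤ d := by exact_mod_cast hd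
  have hs : 0 < √((d : ℝ) - 1) := Real.sqrt_pos.2 (by linarith)
  have hs2 : √((d : ℝ) - 1) * √((d : ℝ) - 1) = d - 1 := Real.mul_self_sqrt (by linarith)
  rw [srwOp, deg_tree (by omega)]
  rcases treeVertex_cases v with ⟨hw, rfl⟩ | ⟨b, l, hw, rfl⟩
  · rw [neighborSet_tree_nil, finsum_mem_range injective_treeWord_singleton,
      finsum_eq_sum_of_fintype]
    simp only [treeWeight, treeRadius, treeWord, List.length_singleton, pow_one, Finset.sum_const,
      Finset.card_univ, Fintype.card_fin, nsmul_eq_mul, List.length_nil, pow_zero, mul_one]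
    rw [div_le_div_iff_of_pos_right (by linarith), ← div_eq_mul_inv, div_le_iff₀ hs, mul_assoc,
      hs2]
    linarith
  · rw [neighborSet_tree_cons, finsum_mem_insert _ (parent_notMem_children b l hw)
      (Set.finite_range _), finsum_mem_range (injective_treeChild b l hw),
      finsum_eq_sum_of_fintype]
    simp only [treeWeight, treeRadius, treeChild, treeWord, List.length_cons, Finset.sum_const,
      Finset.card_univ, Fintype.card_subtype_compl, Fintype.card_fin, nsmul_eq_mul,
      Fintype.card_unique]
    rw [Nat.cast_sub (by omega), Nat.cast_one]
    generalize √((d : ℝ) - 1) = s at hs hs2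
    rw [← hs2]
    apply le_of_eq
    rw [pow_succ _ (l.length + 1), pow_succ]
    field_simp
    ring

theorem tree_lazyProb_self_le (hd : 3 ≤ d) (k : ℕ) (v : TreeVertex d) :
    lazyProb (tree d) k v v ≤ ((1 + treeRadius d) / 2) ^ k := by
  have h := abs_lazyProb_le (fun v => by rw [deg_tree (by omega)]; omega) (treeWeight_pos hd)
    (srwOp_treeWeight_le hd) (treeRadius_pos hd).le k v v
  rw [mul_right_comm, inv_mul_cancel₀ (treeWeight_pos hd v).ne', one_mul] at h
  exact (le_abs_self _).trans h

theorem hasSum_tree_lazyProb (hd : 3 ≤ d) (v w : TreeVertex d) :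
    HasSum (fun k => lazyProb (tree d) k v w / 2) (green (tree d) v w) :=
  hasSum_lazyProb_div_two (fun v => by rw [deg_tree (by omega)]; omega) (treeWeight_pos hd)
    (srwOp_treeWeight_le hd) (treeRadius_pos hd).le (treeRadius_lt_one hd) v w

end Tree

/-! ### Finite regular graphs -/

/-- A symmetric operator is bounded by any bound on its eigenvalues. -/
theorem norm_apply_le_of_isSymmetric {E : Type*} [NormedAddCommGroup E] [InnerProductSpace ℝ E]
    [FiniteDimensional ℝ E] {A : E →ₗ[ℝ] E} (hA : A.IsSymmetric) {θ : ℝ}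
    (hθ : ∀ (m : ℝ) (v : E), v ≠ 0 → A v = m • v → |m| ≤ θ) (v : E) : ‖A v‖ ≤ θ * ‖v‖ := by
  set b := hA.eigenvectorBasis rfl
  have hev : ∀ i, |hA.eigenvalues rfl i| ≤ θ := fun i =>
    hθ _ (b i) (b.orthonormal.ne_zero i) (hA.apply_eigenvectorBasis rfl i)
  rcases eq_or_ne v 0 with rfl | hv
  · simp
  have hθ0 : 0 ≤ θ := by
    by_contra! hneg
    refine hv ((b.repr.map_eq_zero_iff).1 ?_)
    ext i
    exact absurd (hev i) (not_le.2 (hneg.trans_le (abs_nonneg _)))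
  refine le_of_sq_le_sq ?_ (by positivity)
  rw [← b.sum_sq_norm_inner_right, mul_pow, ← b.sum_sq_norm_inner_right, Finset.mul_sum]
  refine Finset.sum_le_sum fun i _ => ?_
  rw [← b.repr_apply_apply, ← b.repr_apply_apply, hA.eigenvectorBasis_apply_self_apply]
  simp only [norm_mul, mul_pow, RCLike.ofReal_real_eq_id, id_eq, Real.norm_eq_abs]
  gcongr
  exact hev i

section Finite

variable {V : Type*} [Fintype V] {G : SimpleGraph V} {d : ℕ}

theorem srwOp_eq_sum_ite [DecidableRel G.Adj] (f : V → ℝ) (x : V) :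
    srwOp G f x = (∑ y, if G.Adj x y then f y else 0) / (deg G x : ℝ) := by
  rw [srwOp, ← Finset.sum_filter, ← finsum_mem_coe_finset]
  simp [SimpleGraph.neighborSet]

theorem sum_srwOp_mul (hG : ∀ x, deg G x = d) (f g : V → ℝ) :
    ∑ x, srwOp G f x * g x = ∑ x, f x * srwOp G g x := by
  classical
  simp_rw [srwOp_eq_sum_ite, hG, div_mul_eq_mul_div, mul_div_assoc', Finset.sum_mul,
    Finset.mul_sum, ← Finset.sum_div]
  rw [Finset.sum_comm]
  refine congrArg (· / (d : ℝ)) (Finset.sum_congr rfl fun x _ => Finset.sum_congr rfl fun y _ => ?_)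
  rw [G.adj_comm]
  split_ifs <;> ring

theorem sum_lazyOp_mul (hG : ∀ x, deg G x = d) (f g : V → ℝ) :
    ∑ x, lazyOp G f x * g x = ∑ x, f x * lazyOp G g x := by
  have h := sum_srwOp_mul hG f g
  simp_rw [lazyOp, add_mul, mul_add, Finset.sum_add_distrib, div_mul_eq_mul_div, mul_div_assoc',
    ← Finset.sum_div, h]

theorem sum_lazyOp (hd : d ≠ 0) (hG : ∀ x, deg G x = d) (f : V → ℝ) :
    ∑ x, lazyOp G f x = ∑ x, f x := by
  have h := sum_lazyOp_mul hG f (fun _ => 1)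
  have h1 : ∀ x, lazyOp G (fun _ => 1) x = 1 := fun x => by
    rw [lazyOp, srwOp_const (by rwa [hG])]; norm_num
  simpa [h1] using h

theorem sum_lazyProb_left (hd : d ≠ 0) (hG : ∀ x, deg G x = d) (k : ℕ) (y : V) :
    ∑ x, lazyProb G k x y = 1 := by
  classical
  induction k with
  | zero => simp [lazyProb, pointInd_apply]
  | succ k ih =>
    rw [← ih]
    simp_rw [lazyProb, Function.iterate_succ_apply']
    exact sum_lazyOp hd hG _

theorem sum_lazyProb_right (hd : d ≠ 0) (hG : ∀ x, deg G x = d) (k : ℕ) (x : V) :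
    ∑ y, lazyProb G k x y = 1 := by
  simp_rw [fun y => lazyProb_comm hd hG k x y]
  exact sum_lazyProb_left hd hG k x

theorem abs_le_one_of_srwOp_eq (hG : ∀ x, deg G x ≠ 0) {f : V → ℝ} (hf : f ≠ 0) {l : ℝ}
    (h : srwOp G f = fun x => l * f x) : |l| ≤ 1 := by
  obtain ⟨x₀, hx₀⟩ := Function.ne_iff.1 hf
  obtain ⟨x, -, hx⟩ := Finset.exists_max_image Finset.univ (fun x => |f x|) ⟨x₀, Finset.mem_univ _⟩
  have hpos : 0 < |f x| := (abs_pos.2 hx₀).trans_le (hx x₀ (Finset.mem_univ _))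
  have h1 := abs_srwOp_le (h := fun _ => 1) (ρ := 1) hG
    (fun y => by rw [srwOp_const (hG y), one_mul]) (abs_nonneg (f x)) (f := f)
    (fun y => by simpa using hx y (Finset.mem_univ _)) x
  rw [h, abs_mul, mul_one, mul_one] at h1
  exact le_of_mul_le_mul_right (h1.trans_eq (one_mul _).symm) hpos

/-- The lazy walk operator minus the projection onto the constants. -/
def centredLazy (G : SimpleGraph V) : EuclideanSpace ℝ V →ₗ[ℝ] EuclideanSpace ℝ V where
  toFun f := WithLp.toLp 2 fun x => lazyOp G f x - (∑ y, f y) / (Fintype.card V : ℝ)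
  map_add' f g := by
    classical
    ext x
    simp only [lazyOp, srwOp_eq_sum_ite, PiLp.add_apply, Finset.sum_add_distrib,
      ← Finset.sum_filter]
    ring
  map_smul' c f := by
    classical
    ext x
    simp only [lazyOp, srwOp_eq_sum_ite, PiLp.smul_apply, ← Finset.sum_filter, ← Finset.mul_sum,
      smul_eq_mul, RingHom.id_apply]
    ring

theorem centredLazy_apply (f : EuclideanSpace ℝ V) (x : V) :
    centredLazy G f x = lazyOp G f x - (∑ y, f y) / (Fintype.card V : ℝ) := rfl

theorem isSymmetric_centredLazy (hG : ∀ x, deg G x = d) : (centredLazy G).IsSymmetric := by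
  intro f g
  simp only [PiLp.inner_apply, centredLazy_apply, RCLike.inner_apply, conj_trivial, sub_mul,
    mul_sub, Finset.sum_sub_distrib, ← Finset.sum_mul, ← Finset.mul_sum]
  have := sum_lazyOp_mul hG f g
  simp_rw [mul_comm (lazyOp G (f : V → ℝ) _)] at this
  rw [this]
  simp_rw [mul_comm (lazyOp G (g : V → ℝ) _)]
  ring

/-- On functions of mean zero, the spectrum of the lazy walk lies in `[0, 1 - β / 2]`. -/
theorem norm_centredLazy_le (hd : d ≠ 0) (hG : ∀ x, deg G x = d) {β θ : ℝ}
    (hgap : β ≤ spectralGap G) (hθ0 : 0 ≤ θ) (hθ : 1 - β / 2 ≤ θ) (f : EuclideanSpace ℝ V) :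
    ‖centredLazy G f‖ ≤ θ * ‖f‖ := by
  have hG' : ∀ x, deg G x ≠ 0 := fun x => by rwa [hG]
  refine norm_apply_le_of_isSymmetric (isSymmetric_centredLazy hG) (fun m v hv hm => ?_) f
  rcases eq_or_ne m 0 with rfl | hm0
  · simpa using hθ0
  have hx : ∀ x, lazyOp G v x - (∑ y, v y) / (Fintype.card V : ℝ) = m * v x := fun x => by
    rw [← centredLazy_apply, hm]; rfl
  have hv' : (v : V → ℝ) ≠ 0 := fun h => hv (by ext x; exact congrFun h x)
  obtain ⟨x₀, -⟩ := Function.ne_iff.1 hv'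
  have hsum : ∑ x, v x = 0 := by
    have h1 := Finset.sum_congr (rfl : (Finset.univ : Finset V) = _) fun x _ => hx x
    have hN : (Fintype.card V : ℝ) ≠ 0 := Nat.cast_ne_zero.2 (Fintype.card_pos_iff.2 ⟨x₀⟩).ne'
    rw [Finset.sum_sub_distrib, sum_lazyOp hd hG, Finset.sum_const, Finset.card_univ,
      nsmul_eq_mul, mul_div_cancel₀ _ hN, sub_self, ← Finset.mul_sum] at h1
    exact (mul_eq_zero.1 h1.symm).resolve_left hm0
  have hsrw : srwOp G v = fun x => (1 - (2 - 2 * m)) * v x := by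
    ext x
    have := hx x
    rw [hsum, zero_div, sub_zero, lazyOp] at this
    linarith
  have h1 := abs_le.1 (abs_le_one_of_srwOp_eq hG' hv' hsrw)
  have h2 : spectralGap G ≤ 2 - 2 * m := by
    refine csInf_le ⟨0, ?_⟩ ⟨v, hv', ?_, hsrw⟩
    · rintro g ⟨f, hf, -, hfg⟩
      linarith [(abs_le.1 (abs_le_one_of_srwOp_eq hG' hf hfg)).2]
    · rw [finsum_eq_sum_of_fintype]
      simp_rw [hG, ← Finset.mul_sum]
      rw [hsum, mul_zero]
  rw [abs_le]
  constructor <;> linarith [h1.1]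

theorem abs_lazyProb_sub_le (hd : d ≠ 0) (hG : ∀ x, deg G x = d) {β θ : ℝ}
    (hgap : β ≤ spectralGap G) (hθ0 : 0 ≤ θ) (hθ : 1 - β / 2 ≤ θ) (k : ℕ) (x y : V) :
    |lazyProb G k x y - 1 / (Fintype.card V : ℝ)| ≤ θ ^ k := by
  classical
  have hG' : ∀ x, deg G x ≠ 0 := fun x => by rwa [hG]
  have hN : (0 : ℝ) < Fintype.card V := Nat.cast_pos.2 (Fintype.card_pos_iff.2 ⟨x⟩)
  set p : ℕ → EuclideanSpace ℝ V := fun k =>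
    WithLp.toLp 2 fun x => lazyProb G k x y - 1 / (Fintype.card V : ℝ) with hp
  have hsum : ∀ k, ∑ x, p k x = 0 := fun k => by
    simp only [hp]
    rw [Finset.sum_sub_distrib, sum_lazyProb_left hd hG, Finset.sum_const, Finset.card_univ,
      nsmul_eq_mul, mul_one_div_cancel hN.ne', sub_self]
  have hstep : ∀ k, centredLazy G (p k) = p (k + 1) := fun k => by
    ext z
    rw [centredLazy_apply, hsum]
    simp only [hp, lazyProb, Function.iterate_succ_apply', lazyOp, srwOp_eq_sum (hG' z),
      Finset.sum_sub_distrib, Finset.sum_const, card_neighbors (hG' z), nsmul_eq_mul]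
    have := Nat.cast_ne_zero (R := ℝ).2 (hG' z)
    field_simp
    ring
  have hnorm : ∀ k, ‖p k‖ ≤ θ ^ k := fun k => by
    induction k with
    | zero =>
      rw [pow_zero, EuclideanSpace.norm_eq]
      refine Real.sqrt_le_one.2 ?_
      simp only [hp, lazyProb, Function.iterate_zero, id_eq, pointInd_apply, Real.norm_eq_abs,
        sq_abs, sub_sq, Finset.sum_add_distrib, Finset.sum_sub_distrib, Finset.sum_const,
        Finset.card_univ, nsmul_eq_mul, ← Finset.sum_mul, ← Finset.mul_sum, ite_pow, one_pow,
        zero_pow two_ne_zero, Finset.sum_ite_eq', Finset.mem_univ, if_true]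
      have : (Fintype.card V : ℝ) * (1 / (Fintype.card V : ℝ)) ^ 2 = 1 / (Fintype.card V : ℝ) := by
        field_simp
      have := one_div_pos.2 hN
      linarith
    | succ k ih =>
      rw [← hstep, pow_succ']
      exact (norm_centredLazy_le hd hG hgap hθ0 hθ _).trans (mul_le_mul_of_nonneg_left ih hθ0)
  exact (PiLp.norm_apply_le (p k) x).trans (hnorm k)

theorem two_mul_ncard_edgeSet (hG : ∀ x, deg G x = d) :
    2 * G.edgeSet.ncard = d * Fintype.card V := by
  classical
  have h := G.sum_degrees_eq_twice_card_edges
  have h1 : ∀ x, G.degree x = d := fun x => by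
    rw [← hG x, deg, Set.ncard_eq_toFinset_card']
    rfl
  simp_rw [h1, Finset.sum_const, Finset.card_univ, smul_eq_mul] at h
  rw [Set.ncard_eq_toFinset_card', mul_comm d, h]
  rfl

theorem invDist_eq (hd : d ≠ 0) (hG : ∀ x, deg G x = d) (x : V) :
    invDist G x = 1 / (Fintype.card V : ℝ) := by
  have h : (2 : ℝ) * (G.edgeSet.ncard : ℝ) = d * Fintype.card V := by
    exact_mod_cast two_mul_ncard_edgeSet hG
  have hd' : (d : ℝ) ≠ 0 := Nat.cast_ne_zero.2 hd
  have hN : (Fintype.card V : ℝ) ≠ 0 := Nat.cast_ne_zero.2 (Fintype.card_pos_iff.2 ⟨x⟩).ne'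
  rw [invDist, h, hG]
  field_simp

theorem hasSum_zeroAvgGreen (hd : d ≠ 0) (hG : ∀ x, deg G x = d) {β : ℝ} (hβ : 0 < β)
    (hgap : β ≤ spectralGap G) (x y : V) :
    HasSum (fun k => (lazyProb G k x y - 1 / (Fintype.card V : ℝ)) / 2)
      ((d : ℝ) / 2 * (zeroAvgGreen G x y / (deg G y : ℝ))) := by
  have hs : Summable fun k => lazyProb G k x y - 1 / (Fintype.card V : ℝ) :=
    (summable_geometric_of_lt_one (le_max_right (1 - β / 2) 0)
      (max_lt (by linarith) one_pos)).of_norm_bounded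
      fun k => abs_lazyProb_sub_le hd hG hgap (le_max_right _ _) (le_max_left _ _) k x y
  have hd' : (d : ℝ) ≠ 0 := Nat.cast_ne_zero.2 hd
  have h : (d : ℝ) / 2 * (zeroAvgGreen G x y / (deg G y : ℝ)) =
      (∑' k, (lazyProb G k x y - 1 / (Fintype.card V : ℝ))) / 2 := by
    simp only [zeroAvgGreen, hG, invDist_eq hd hG]
    field_simp
  rw [h]
  exact hs.hasSum.div_const 2

/-- At the vertices of `G`, the projection `Π` is the average over the vertices of `G`. -/
theorem xi_eq (hd : d ≠ 0) (hG : ∀ x, deg G x = d) (k : ℕ) (z : SubdivVertex G → ℝ) (x : V) :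
    xi G k z x = zeta G k z x - (∑ v, zeta G k z v) / (Fintype.card V : ℝ) := by
  classical
  have hN : (Fintype.card V : ℝ) ≠ 0 := Nat.cast_ne_zero.2 (Fintype.card_pos_iff.2 ⟨x⟩).ne'
  have hd' : (d : ℝ) ≠ 0 := Nat.cast_ne_zero.2 hd
  have hE : (Fintype.card G.edgeSet : ℝ) * 2 = d * Fintype.card V := by
    have := two_mul_ncard_edgeSet hG
    rw [← Nat.card_coe_set_eq, Nat.card_eq_fintype_card, mul_comm] at this
    exact_mod_cast this
  have hinner : ∀ f g : SubdivVertex G → ℝ, inner2 G f g =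
      (∑ v, f (Sum.inl v) * g (Sum.inl v)) * d + (∑ e, f (Sum.inr e) * g (Sum.inr e)) * 2 :=
    fun f g => by
      rw [inner2, finsum_eq_sum_of_fintype, Fintype.sum_sum_type]
      simp only [deg_subdiv_inl, deg_subdiv_inr, hG, Finset.sum_mul, Nat.cast_ofNat]
  rw [xi, proj]
  simp only [hinner, signFn, Sum.elim_inl, Sum.elim_inr, mul_one, mul_neg, neg_neg,
    Finset.sum_const, Finset.card_univ, nsmul_eq_mul, Finset.sum_neg_distrib, hE]
  change zeta G k z x - _ = _
  congr 1
  change ((∑ v, zeta G k z v) * d + _) / _ + ((∑ v, zeta G k z v) * d + _) / _ = _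
  generalize ∑ v, zeta G k z v = a
  generalize ∑ e, (srwOp (subdiv G))^[k] z (Sum.inr e) = b
  field_simp
  ring

variable {Ω : Type*} [MeasurableSpace Ω] {μ : Measure Ω}

theorem IsNoise.isCentredGaussianField_xi (hd : d ≠ 0) (hG : ∀ x, deg G x = d)
    {Z : ℕ → SubdivVertex G → Ω → ℝ} (hZ : IsNoise μ G ((d : ℝ) / 2) Z) :
    IsCentredGaussianField μ (fun (p : ℕ × V) ω => xi G p.1 (fun z => Z p.1 z ω) p.2)
      (fun p p' => if p.1 = p'.1 then
        (lazyProb G p.1 p.2 p'.2 - 1 / (Fintype.card V : ℝ)) / 2 else 0) := by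
  classical
  have h0 := (hZ.isCentredGaussianField_zeta hd hG).sum
    (fun p : ℕ × V => {p.1} ×ˢ (Finset.univ : Finset V))
    (fun p t => (if t.2 = p.2 then 1 else 0) - 1 / (Fintype.card V : ℝ))
  convert h0 using 1
  · ext p ω
    simp only [Finset.sum_product, Finset.sum_singleton, sub_mul, ite_mul, one_mul, zero_mul,
      Finset.sum_sub_distrib, Finset.sum_ite_eq', Finset.mem_univ, if_true, ← Finset.mul_sum]
    rw [xi_eq hd hG]
    ring
  · ext ⟨k, x⟩ ⟨l, y⟩
    simp only [Finset.sum_product, Finset.sum_singleton]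
    split_ifs with hkl
    · subst hkl
      have hN : (Fintype.card V : ℝ) ≠ 0 :=
        Nat.cast_ne_zero.2 (Fintype.card_pos_iff.2 ⟨x⟩).ne'
      have h1 : ∀ v, ∑ w, ((if w = y then 1 else 0) - 1 / (Fintype.card V : ℝ)) *
          lazyProb G k v w = lazyProb G k v y - 1 / (Fintype.card V : ℝ) := fun v => by
        simp only [sub_mul, ite_mul, one_mul, zero_mul, Finset.sum_sub_distrib,
          Finset.sum_ite_eq', Finset.mem_univ, if_true, ← Finset.mul_sum,
          sum_lazyProb_right hd hG, mul_one]
      simp_rw [mul_div_assoc', mul_assoc, ← Finset.sum_div, ← Finset.mul_sum, h1]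
      congr 1
      simp only [sub_mul, ite_mul, one_mul, zero_mul, Finset.sum_sub_distrib,
          Finset.sum_ite_eq', Finset.mem_univ, if_true, ← Finset.mul_sum,
          sum_lazyProb_left hd hG, Finset.sum_const, Finset.card_univ, nsmul_eq_mul]
      field_simp
      ring
    · simp

/-- The averages over `V` of the first `m` fields `Q ^ k Z_k` add up to a Gaussian variable of
variance `m / (2 |V|)`. -/
theorem IsNoise.isCentredGaussianField_average [Nonempty V] (hd : d ≠ 0) (hG : ∀ x, deg G x = d)
    {Z : ℕ → SubdivVertex G → Ω → ℝ} (hZ : IsNoise μ G ((d : ℝ) / 2) Z) (m : ℕ) :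
    IsCentredGaussianField μ (fun (_ : Unit) ω => ∑ k ∈ Finset.range m,
      (∑ v, zeta G k (fun z => Z k z ω) v) / (Fintype.card V : ℝ))
      (fun _ _ => (m : ℝ) / (2 * (Fintype.card V : ℝ))) := by
  classical
  have h0 := (hZ.isCentredGaussianField_zeta hd hG).sum
    (fun _ : Unit => Finset.range m ×ˢ (Finset.univ : Finset V))
    (fun _ _ => 1 / (Fintype.card V : ℝ))
  have hN : (Fintype.card V : ℝ) ≠ 0 := Nat.cast_ne_zero.2 Fintype.card_pos.ne'
  convert h0 using 1
  · ext _ ω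
    simp only [Finset.sum_product, ← Finset.mul_sum, Finset.sum_div]
    simp_rw [Finset.mul_sum]
    refine Finset.sum_congr rfl fun k _ => Finset.sum_congr rfl fun v _ => ?_
    ring
  · ext _ _
    simp only [Finset.sum_product, ← Finset.mul_sum]
    have h1 : ∀ k ∈ Finset.range m, ∑ v : V, ∑ l ∈ Finset.range m, ∑ w : V,
        (if k = l then lazyProb G k v w / 2 else 0) = (Fintype.card V : ℝ) / 2 := fun k hk => by
      have : ∀ v : V, ∑ l ∈ Finset.range m, ∑ w : V,
          (if k = l then lazyProb G k v w / 2 else 0) = 1 / 2 := fun v => by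
        rw [Finset.sum_comm]
        simp only [Finset.sum_ite_eq, hk, if_true, ← Finset.sum_div, sum_lazyProb_right hd hG]
      simp only [this, Finset.sum_const, Finset.card_univ, nsmul_eq_mul]
      ring
    rw [Finset.sum_congr rfl h1, Finset.sum_const, Finset.card_range, nsmul_eq_mul]
    field_simp

end Finite

/-! ### The free fields as series, and their tails -/

section Series

variable {Ω T : Type*} [MeasurableSpace Ω] {μ : Measure Ω}

theorem IsCentredGaussianField.ae_summable_of_le [Countable T] {U : ℕ × T → Ω → ℝ}
    {M : ℕ → T → T → ℝ}
    (hU : IsCentredGaussianField μ U (fun p p' => if p.1 = p'.1 then M p.1 p.2 p'.2 else 0))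
    {θ : ℝ} (hθ0 : 0 < θ) (hθ1 : θ < 1) (hM : ∀ k t, M k t t ≤ θ ^ k / 2) :
    ∀ᵐ ω ∂μ, ∀ t, Summable fun k => U (k, t) ω := by
  refine hU.ae_summable (q := √θ) (Real.sqrt_pos.2 hθ0) ((Real.sqrt_lt' one_pos).2 (by simpa))
    (fun _ => 1 / 2) fun k t => ?_
  rw [if_pos rfl, ← pow_mul, mul_comm k, pow_mul, Real.sq_sqrt hθ0.le]
  linarith [hM k t]

/-- Tail bound for the remainder of the series of layers with variances at most `θ ^ k / 2`. -/
theorem IsCentredGaussianField.measure_abs_tsum_add_gt_le [Countable T] {U : ℕ × T → Ω → ℝ}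
    {M : ℕ → T → T → ℝ}
    (hU : IsCentredGaussianField μ U (fun p p' => if p.1 = p'.1 then M p.1 p.2 p'.2 else 0))
    {θ : ℝ} (hθ0 : 0 < θ) (hθ1 : θ < 1) (hM : ∀ k t, M k t t ≤ θ ^ k / 2) (m : ℕ) (t : T)
    {ε : ℝ} (hε : 0 ≤ ε) :
    μ.real {ω | ε < |∑' k, U (k + m, t) ω|} ≤ 2 * Real.exp (-(ε ^ 2 * (1 - θ) / θ ^ m)) := by
  have hnn : ∀ k, 0 ≤ M k t t := fun k => by simpa using hU.cov_self_nonneg (k, t)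
  have hgeom : HasSum (fun k => θ ^ (k + m) / 2) ((1 - θ)⁻¹ * θ ^ m / 2) := by
    simp_rw [pow_add]
    exact ((hasSum_geometric_of_lt_one hθ0.le hθ1).mul_right _).div_const 2
  have hs : Summable fun k => M (k + m) t t :=
    Summable.of_nonneg_of_le (fun k => hnn _) (fun k => hM _ t) hgeom.summable
  have hf := hU.comp (fun p : ℕ × Unit => (p.1 + m, t))
  simp only [add_left_inj] at hf
  have hae : ∀ᵐ ω ∂μ, HasSum (fun k => U (k + m, t) ω) (∑' k, U (k + m, t) ω) := by
    filter_upwards [hU.ae_summable_of_le hθ0 hθ1 hM] with ω hω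
    exact ((summable_nat_add_iff m).2 (hω t)).hasSum
  have hX : IsCentredGaussianField μ (fun (_ : Unit) ω => ∑' k, U (k + m, t) ω)
      (fun _ _ => ∑' k, M (k + m) t t) :=
    IsCentredGaussianField.tsum (M := fun k _ _ => M (k + m) t t) hf (fun _ => hae)
      (fun _ _ => hs.hasSum)
  have hle : ∑' k, M (k + m) t t ≤ (1 - θ)⁻¹ * θ ^ m / 2 :=
    hasSum_le (fun k => hM (k + m) t) hs.hasSum hgeom
  have h1 : (0 : ℝ) < 1 - θ := by linarith
  refine (hX.measure_abs_gt_le () hle (by positivity) hε).trans_eq ?_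
  congr 2
  field_simp

theorem IsNoise.treeGFF {d : ℕ} (hd : 3 ≤ d) {W : ℕ → SubdivVertex (tree d) → Ω → ℝ}
    (hW : IsNoise μ (tree d) ((d : ℝ) / 2) W) {φ : TreeVertex d → Ω → ℝ}
    (hφ : ∀ᵐ ω ∂μ, ∀ v, HasSum (fun k => zeta (tree d) k (fun z => W k z ω) v) (φ v ω)) :
    IsTreeGFF μ d φ :=
  (hW.isCentredGaussianField_zeta (by omega) (deg_tree (by omega))).tsum
    (M := fun k v w => lazyProb (tree d) k v w / 2)
    (fun v => hφ.mono fun _ h => h v) (hasSum_tree_lazyProb hd)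

theorem IsNoise.zeroAvgGFF {V : Type*} [Fintype V] {G : SimpleGraph V} {d : ℕ} (hd : d ≠ 0)
    (hG : ∀ x, deg G x = d) {β : ℝ} (hβ : 0 < β) (hgap : β ≤ spectralGap G)
    {Z : ℕ → SubdivVertex G → Ω → ℝ} (hZ : IsNoise μ G ((d : ℝ) / 2) Z) {Ψ : V → Ω → ℝ}
    (hΨ : ∀ᵐ ω ∂μ, ∀ y, HasSum (fun k => xi G k (fun z => Z k z ω) y) (Ψ y ω)) :
    IsZeroAvgGFF μ G ((d : ℝ) / 2) Ψ :=
  (hZ.isCentredGaussianField_xi hd hG).tsum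
    (M := fun k x y => (lazyProb G k x y - 1 / (Fintype.card V : ℝ)) / 2)
    (fun y => hΨ.mono fun _ h => h y) (hasSum_zeroAvgGreen hd hG hβ hgap)

/-- A common geometric rate for the decay of the lazy walk on the `d`-regular tree and, around the
equilibrium, on finite `d`-regular graphs with spectral gap at least `β`. -/
def decayRate (d : ℕ) (β : ℝ) : ℝ := max (1 - β / 2) ((1 + treeRadius d) / 2)

theorem decayRate_pos {d : ℕ} (hd : 3 ≤ d) (β : ℝ) : 0 < decayRate d β :=
  lt_max_of_lt_right (by linarith [treeRadius_pos hd])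

theorem decayRate_lt_one {d : ℕ} (hd : 3 ≤ d) {β : ℝ} (hβ : 0 < β) : decayRate d β < 1 :=
  max_lt (by linarith) (by linarith [treeRadius_lt_one hd])

theorem tree_lazyProb_self_le_decayRate {d : ℕ} (hd : 3 ≤ d) (β : ℝ) (k : ℕ) (v : TreeVertex d) :
    lazyProb (tree d) k v v / 2 ≤ decayRate d β ^ k / 2 := by
  refine div_le_div_of_nonneg_right ((tree_lazyProb_self_le hd k v).trans ?_) two_pos.le
  exact pow_le_pow_left₀ (by linarith [treeRadius_pos hd]) (le_max_right _ _) k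

theorem lazyProb_sub_le_decayRate {V : Type*} [Fintype V] {G : SimpleGraph V} {d : ℕ} (hd : 3 ≤ d)
    (hG : ∀ x, deg G x = d) {β : ℝ} (hgap : β ≤ spectralGap G) (k : ℕ) (x : V) :
    (lazyProb G k x x - 1 / (Fintype.card V : ℝ)) / 2 ≤ decayRate d β ^ k / 2 := by
  refine div_le_div_of_nonneg_right ((le_abs_self _).trans ?_) two_pos.le
  exact abs_lazyProb_sub_le (by omega) hG hgap (decayRate_pos hd β).le (le_max_left _ _) k x x

end Series

/-! ### Construction of the coupled noises -/

section Noises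

theorem exists_independent_gaussians {I : Type*} [Countable I] (v : I → ℝ≥0) :
    ∃ (Ω : Type) (_ : MeasurableSpace Ω) (Q : Measure Ω) (Y : I → Ω → ℝ),
      IsProbabilityMeasure Q ∧ iIndepFun Y Q ∧ ∀ i, HasLaw (Y i) (gaussianReal 0 (v i)) Q := by
  obtain ⟨enc, henc⟩ := exists_injective_nat I
  have hcoord : ∀ n : ℕ, HasLaw (fun ω : ℕ → ℝ => ω n) (gaussianReal 0 1)
      (Measure.infinitePi fun _ => gaussianReal 0 1) := fun n =>
    (measurePreserving_eval_infinitePi (fun _ : ℕ => gaussianReal 0 1) n).hasLaw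
  refine ⟨ℕ → ℝ, inferInstance, Measure.infinitePi fun _ => gaussianReal 0 1,
    fun i ω => √(v i : ℝ) * ω (enc i), inferInstance, ?_, fun i => ?_⟩
  · exact ((iIndepFun_infinitePi (P := fun _ : ℕ => gaussianReal 0 1) (X := fun _ x => x)
      (fun _ => measurable_id)).precomp henc).comp (fun i x => √(v i : ℝ) * x)
      fun i => measurable_const_mul _
  · have := gaussianReal_const_mul (hcoord (enc i)) (√(v i : ℝ))
    convert this using 2
    · simp
    · ext; simp

variable {V : Type*} {G : SimpleGraph V} {d R : ℕ} {x x' : V}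

theorem injective_subdivMap {V W : Type*} {G : SimpleGraph V} {H : SimpleGraph W} {f : G →g H}
    (hf : Function.Injective f) : Function.Injective (subdivMap f) :=
  hf.sumMap (SimpleGraph.Hom.mapEdgeSet.injective f hf)

theorem injective_ballIncl (x : V) (R : ℕ) : Function.Injective (ballIncl G x R) :=
  injective_subdivMap Subtype.val_injective

theorem injective_ballIsoExt (ρ : BallIso G d x R) : Function.Injective (ballIsoExt ρ) :=
  (injective_ballIncl (root d) R).comp (injective_subdivMap ρ.1.injective)

theorem subdivMap_iso_surjective {V W : Type*} {G : SimpleGraph V} {H : SimpleGraph W}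
    (f : G ≃g H) : Function.Surjective (subdivMap (f : G →g H)) := by
  rintro (w | ⟨e, he⟩)
  · exact ⟨Sum.inl (f.symm w), congrArg Sum.inl (f.apply_symm_apply w)⟩
  · obtain ⟨e', h'⟩ := f.mapEdgeSet.surjective ⟨e, he⟩
    exact ⟨Sum.inr e', congrArg Sum.inr h'⟩

theorem mem_coupledSet_iff (ρ : BallIso G d x R) (p : ℕ × SubdivVertex (tree d)) :
    p ∈ coupledSet d R ↔ ∃ k ≤ R, ∃ u, p = (k, ballIsoExt ρ u) := by
  constructor
  · rintro ⟨hk, u, hu⟩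
    obtain ⟨u', rfl⟩ := subdivMap_iso_surjective ρ.1 u
    exact ⟨p.1, hk, u', Prod.ext rfl hu.symm⟩
  · rintro ⟨k, hk, u, rfl⟩
    exact ⟨hk, _, rfl⟩

/-- The source of the noise at a space-time point of the subdivided tree: a space-time point of the
subdivided graph `G` if the point is coupled, and the point itself otherwise. -/
theorem exists_noise_source (ρ : BallIso G d x R) :
    ∃ j : ℕ × SubdivVertex (tree d) → (ℕ × SubdivVertex G) ⊕ {p // p ∉ coupledSet d R},
      Function.Injective j ∧ (∀ k ≤ R, ∀ u, j (k, ballIsoExt ρ u) = Sum.inl (k, ballIncl G x R u)) ∧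
      ∀ p (h : p ∉ coupledSet d R), j p = Sum.inr ⟨p, h⟩ := by
  classical
  have hex : ∀ p : ℕ × SubdivVertex (tree d), p ∈ coupledSet d R →
      ∃ u, p.2 = ballIsoExt ρ u := fun p hp => by
    obtain ⟨k, -, u, rfl⟩ := (mem_coupledSet_iff ρ p).1 hp
    exact ⟨u, rfl⟩
  choose b hb using hex
  have hj : ∀ k u h, b (k, ballIsoExt ρ u) h = u := fun k u h =>
    (injective_ballIsoExt ρ (hb _ h)).symm
  refine ⟨fun p => if h : p ∈ coupledSet d R then Sum.inl (p.1, ballIncl G x R (b p h))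
    else Sum.inr ⟨p, h⟩, fun p p' hpp => ?_, fun k hk u => ?_, fun p h => dif_neg h⟩
  · by_cases h : p ∈ coupledSet d R <;> by_cases h' : p' ∈ coupledSet d R
    · simp only [h, h', dif_pos, Sum.inl.injEq, Prod.mk.injEq] at hpp
      refine Prod.ext hpp.1 ?_
      rw [hb p h, hb p' h', injective_ballIncl x R hpp.2]
    · simp [h, h'] at hpp
    · simp [h, h'] at hpp
    · simpa [h, h'] using hpp
  · refine (dif_pos ((mem_coupledSet_iff ρ _).2 ⟨k, hk, u, rfl⟩)).trans ?_
    rw [hj]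

theorem deg_subdiv_ballIsoExt (hd : d ≠ 0) (hG : ∀ x, deg G x = d) (ρ : BallIso G d x R) (u) :
    deg (subdiv (tree d)) (ballIsoExt ρ u) = deg (subdiv G) (ballIncl G x R u) := by
  rcases u with u | e
  · exact (deg_subdiv_inl _).trans ((deg_tree hd _).trans (((deg_subdiv_inl _).trans (hG _)).symm))
  · exact (deg_subdiv_inr _).trans (deg_subdiv_inr _).symm

theorem ballIncl_ne (h : Disjoint (cball G x R) (cball G x' R)) (u u') :
    ballIncl G x R u ≠ ballIncl G x' R u' := by
  intro e
  rcases u with a | ⟨w, hw⟩ <;> rcases u' with a' | ⟨w', hw'⟩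
  · have e' : a.1 = a'.1 := Sum.inl.inj e
    exact Set.disjoint_left.1 h a.2 (e' ▸ a'.2)
  · cases e
  · cases e
  · induction w with | _ a b =>
    induction w' with | _ a' b' =>
    have e' : s(a.1, b.1) = s(a'.1, b'.1) := congrArg Subtype.val (Sum.inr.inj e)
    have hm : a.1 ∈ s(a'.1, b'.1) := e' ▸ Sym2.mem_mk_left _ _
    rcases Sym2.mem_iff.1 hm with h1 | h1
    · exact Set.disjoint_left.1 h a.2 (h1 ▸ a'.2)
    · exact Set.disjoint_left.1 h a.2 (h1 ▸ b'.2)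

theorem measurable_zeta {G : SimpleGraph V} (hG : ∀ x, deg G x ≠ 0) (k : ℕ) (y : V) :
    Measurable fun z : ℕ × SubdivVertex G → ℝ => zeta G k (fun s => z (k, s)) y := by
  obtain ⟨s, -, hs⟩ := exists_srwOp_iterate_eq_sum (deg_subdiv_ne_zero hG) k (Sum.inl y)
  simp only [zeta, hs]
  fun_prop

variable {Ω : Type*} [MeasurableSpace Ω] {μ : Measure Ω}

theorem indepFun_series [Countable V] {G : SimpleGraph V} (hG : ∀ x, deg G x ≠ 0)
    {W W' : ℕ → SubdivVertex G → Ω → ℝ}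
    (hind : IndepFun (fun ω (p : ℕ × SubdivVertex G) => W p.1 p.2 ω)
      (fun ω (p : ℕ × SubdivVertex G) => W' p.1 p.2 ω) μ) {φ φ' : V → Ω → ℝ}
    (hφ : ∀ᵐ ω ∂μ, ∀ v, HasSum (fun k => zeta G k (fun z => W k z ω) v) (φ v ω))
    (hφ' : ∀ᵐ ω ∂μ, ∀ v, HasSum (fun k => zeta G k (fun z => W' k z ω) v) (φ' v ω)) :
    IndepFun (fun ω v => φ v ω) (fun ω v => φ' v ω) μ := by
  -- The upper limit of the partial sums is a measurable functional of the noise.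
  set F : (ℕ × SubdivVertex G → ℝ) → V → ℝ := fun z v =>
    limsup (fun n => ∑ k ∈ Finset.range n, zeta G k (fun s => z (k, s)) v) atTop with hF
  have hFm : Measurable F := measurable_pi_lambda _ fun v =>
    Measurable.limsup fun n => Finset.measurable_sum _ fun k _ => measurable_zeta hG k v
  refine (hind.comp hFm hFm).congr ?_ ?_
  · filter_upwards [hφ] with ω hω
    ext v
    exact (hω v).tendsto_sum_nat.limsup_eq
  · filter_upwards [hφ'] with ω hω
    ext v
    exact (hω v).tendsto_sum_nat.limsup_eq

/-- On some probability space there is a coupling of the two free fields on the tree with the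
zero-average free field on `G`. -/
theorem exists_isCoupling {V : Type*} [Fintype V] {G : SimpleGraph V} (hd : 3 ≤ d)
    (hG : ∀ x, deg G x = d) {β : ℝ} (hβ : 0 < β) (hgap : β ≤ spectralGap G) {x x' : V}
    (hdisj : Disjoint (cball G x R) (cball G x' R)) (ρ : BallIso G d x R) (ρ' : BallIso G d x' R) :
    ∃ (Ω : Type) (_ : MeasurableSpace Ω) (Q : Measure Ω)
      (Ψ : V → Ω → ℝ) (φ φ' : TreeVertex d → Ω → ℝ)
      (Z : ℕ → SubdivVertex G → Ω → ℝ) (W W' : ℕ → SubdivVertex (tree d) → Ω → ℝ),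
      IsProbabilityMeasure Q ∧ IsCoupling Q G d R x x' ρ ρ' Ψ φ φ' Z W W' := by
  classical
  have hd0 : d ≠ 0 := by omega
  obtain ⟨j, hj_inj, hj_in, hj_out⟩ := exists_noise_source ρ
  obtain ⟨j', hj'_inj, hj'_in, hj'_out⟩ := exists_noise_source ρ'
  set vG : ℕ × SubdivVertex G → ℝ≥0 :=
    fun p => ((d : ℝ) / 2 / (deg (subdiv G) p.2 : ℝ)).toNNReal with hvG
  set vT : ℕ × SubdivVertex (tree d) → ℝ≥0 :=
    fun p => ((d : ℝ) / 2 / (deg (subdiv (tree d)) p.2 : ℝ)).toNNReal with hvT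
  set v : (ℕ × SubdivVertex G) ⊕ ({p // p ∉ coupledSet d R} ⊕ {p // p ∉ coupledSet d R}) → ℝ≥0 :=
    Sum.elim vG (Sum.elim (fun p => vT p.1) (fun p => vT p.1)) with hv
  obtain ⟨Ω, mΩ, Q, Y, hQ, hYind, hYlaw⟩ := exists_independent_gaussians v
  set i₁ := fun p => Sum.map (id : ℕ × SubdivVertex G → _)
    (Sum.inl (β := {p // p ∉ coupledSet d R})) (j p) with hi₁
  set i₂ := fun p => Sum.map (id : ℕ × SubdivVertex G → _)
    (Sum.inr (α := {p // p ∉ coupledSet d R})) (j' p) with hi₂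
  have hi₁_inj : Function.Injective i₁ :=
    (Function.injective_id.sumMap Sum.inl_injective).comp hj_inj
  have hi₂_inj : Function.Injective i₂ :=
    (Function.injective_id.sumMap Sum.inr_injective).comp hj'_inj
  have hv₁ : ∀ p, v (i₁ p) = vT p := fun p => by
    by_cases hp : p ∈ coupledSet d R
    · obtain ⟨k, hk, u, rfl⟩ := (mem_coupledSet_iff ρ p).1 hp
      simp only [hi₁, hj_in k hk, hv, hvG, hvT, Sum.map_inl, Sum.elim_inl, id,
        deg_subdiv_ballIsoExt hd0 hG]
    · simp only [hi₁, hj_out p hp, hv, Sum.map_inr, Sum.elim_inr, Sum.elim_inl]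
  have hv₂ : ∀ p, v (i₂ p) = vT p := fun p => by
    by_cases hp : p ∈ coupledSet d R
    · obtain ⟨k, hk, u, rfl⟩ := (mem_coupledSet_iff ρ' p).1 hp
      simp only [hi₂, hj'_in k hk, hv, hvG, hvT, Sum.map_inl, Sum.elim_inl, id,
        deg_subdiv_ballIsoExt hd0 hG]
    · simp only [hi₂, hj'_out p hp, hv, Sum.map_inr, Sum.elim_inr]
  have hne : ∀ p p', i₁ p ≠ i₂ p' := fun p p' => by
    by_cases hp : p ∈ coupledSet d R <;> by_cases hp' : p' ∈ coupledSet d R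
    · obtain ⟨k, hk, u, rfl⟩ := (mem_coupledSet_iff ρ p).1 hp
      obtain ⟨k', hk', u', rfl⟩ := (mem_coupledSet_iff ρ' p').1 hp'
      simp only [hi₁, hi₂, hj_in k hk, hj'_in k' hk', Sum.map_inl, id, ne_eq, Sum.inl.injEq,
        Prod.mk.injEq, not_and]
      exact fun _ => ballIncl_ne hdisj u u'
    · obtain ⟨k, hk, u, rfl⟩ := (mem_coupledSet_iff ρ p).1 hp
      simp [hi₁, hi₂, hj_in k hk, hj'_out p' hp']
    · obtain ⟨k', hk', u', rfl⟩ := (mem_coupledSet_iff ρ' p').1 hp'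
      simp [hi₁, hi₂, hj_out p hp, hj'_in k' hk']
    · simp [hi₁, hi₂, hj_out p hp, hj'_out p' hp']
  set Z : ℕ → SubdivVertex G → Ω → ℝ := fun k z => Y (Sum.inl (k, z)) with hZdef
  set W : ℕ → SubdivVertex (tree d) → Ω → ℝ := fun k z => Y (i₁ (k, z)) with hWdef
  set W' : ℕ → SubdivVertex (tree d) → Ω → ℝ := fun k z => Y (i₂ (k, z)) with hW'def
  have hZ : IsNoise Q G ((d : ℝ) / 2) Z :=
    ⟨hYind.precomp Sum.inl_injective, fun k z => hYlaw (Sum.inl (k, z))⟩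
  have hW : IsNoise Q (tree d) ((d : ℝ) / 2) W :=
    ⟨hYind.precomp hi₁_inj, fun k z => by
      have := hYlaw (i₁ (k, z))
      rwa [hv₁] at this⟩
  have hW' : IsNoise Q (tree d) ((d : ℝ) / 2) W' :=
    ⟨hYind.precomp hi₂_inj, fun k z => by
      have := hYlaw (i₂ (k, z))
      rwa [hv₂] at this⟩
  have hY := isCentredGaussianField_of_iIndepFun hYind hYlaw
  have hWW' : IndepFun (fun ω (p : ℕ × SubdivVertex (tree d)) => W p.1 p.2 ω)
      (fun ω (p : ℕ × SubdivVertex (tree d)) => W' p.1 p.2 ω) Q := by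
    refine IsGaussianProcess.indepFun_of_covariance_eq_zero
      (X := fun p : ℕ × SubdivVertex (tree d) => W p.1 p.2)
      (Y := fun p : ℕ × SubdivVertex (tree d) => W' p.1 p.2) ?_
      (fun p => hY.gaussian.aemeasurable _) (fun p => hY.gaussian.aemeasurable _) fun p p' => ?_
    · have h : Sum.elim (fun p : ℕ × SubdivVertex (tree d) => W p.1 p.2)
          (fun p => W' p.1 p.2) = Y ∘ Sum.elim i₁ i₂ := by
        ext (p | p) ω <;> rfl
      rw [h]
      exact hY.gaussian.comp_right (Sum.elim i₁ i₂)
    · exact (hY.cov _ _).trans (if_neg (hne p p'))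
  have hθ0 := decayRate_pos hd β
  have hθ1 := decayRate_lt_one hd hβ
  have hsum : ∀ {W : ℕ → SubdivVertex (tree d) → Ω → ℝ}, IsNoise Q (tree d) ((d : ℝ) / 2) W →
      ∀ᵐ ω ∂Q, ∀ v, HasSum (fun k => zeta (tree d) k (fun z => W k z ω) v)
        (∑' k, zeta (tree d) k (fun z => W k z ω) v) := fun hW => by
    filter_upwards [(hW.isCentredGaussianField_zeta hd0 (deg_tree hd0)).ae_summable_of_le
      (M := fun k v w => lazyProb (tree d) k v w / 2) hθ0 hθ1
      (tree_lazyProb_self_le_decayRate hd β)] with ω hω v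
    exact (hω v).hasSum
  have hsumZ : ∀ᵐ ω ∂Q, ∀ y, HasSum (fun k => xi G k (fun z => Z k z ω) y)
        (∑' k, xi G k (fun z => Z k z ω) y) := by
    filter_upwards [(hZ.isCentredGaussianField_xi hd0 hG).ae_summable_of_le
      (M := fun k x y => (lazyProb G k x y - 1 / (Fintype.card V : ℝ)) / 2) hθ0 hθ1
      (lazyProb_sub_le_decayRate hd hG hgap)] with ω hω y
    exact (hω y).hasSum
  refine ⟨Ω, mΩ, Q, fun y ω => ∑' k, xi G k (fun z => Z k z ω) y,
    fun v ω => ∑' k, zeta (tree d) k (fun z => W k z ω) v,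
    fun v ω => ∑' k, zeta (tree d) k (fun z => W' k z ω) v, Z, W, W', hQ, ?_⟩
  exact {
    zeroAvgGFF := hZ.zeroAvgGFF hd0 hG hβ hgap hsumZ
    treeGFF := hW.treeGFF hd (hsum hW)
    treeGFF' := hW'.treeGFF hd (hsum hW')
    indep_fields := indepFun_series (fun v => by rwa [deg_tree hd0]) hWW' (hsum hW) (hsum hW')
    noise := hZ
    treeNoise := hW
    treeNoise' := hW'
    indep_noises := hWW'
    repr := hsumZ
    treeRepr := hsum hW
    treeRepr' := hsum hW'
    agree := ae_of_all _ fun ω k hk u => by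
      simp only [hWdef, hZdef, hi₁, hj_in k hk, Sum.map_inl, id]
    agree' := ae_of_all _ fun ω k hk u => by
      simp only [hW'def, hZdef, hi₂, hj'_in k hk, Sum.map_inl, id]
    otherwise_indep := by
      convert hYind using 1
      ext (p | p | p) ω
      · rfl
      · simp only [Sum.elim_inr, Sum.elim_inl, hWdef, hi₁, Prod.mk.eta, hj_out p.1 p.2,
          Sum.map_inr]
      · simp only [Sum.elim_inr, hW'def, hi₂, Prod.mk.eta, hj'_out p.1 p.2, Sum.map_inr] }

end Noises

/-! ### Agreement of the walks on isomorphic balls -/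

section Ball

variable {V : Type*} {G : SimpleGraph V} {d R : ℕ} {x : V}

theorem cball_mono {r s : ℕ} (h : r ≤ s) : cball G x r ⊆ cball G x s := fun _ hy =>
  le_trans (Set.mem_ofPred.1 hy) (Nat.cast_le.2 h)

theorem mem_cball_succ_of_adj {s : ℕ} {y u : V} (hy : y ∈ cball G x s) (h : G.Adj y u) :
    u ∈ cball G x (s + 1) := by
  have h1 : G.edist x y ≤ s := hy
  have h2 : G.edist y u ≤ 1 := (SimpleGraph.edist_eq_one_iff_adj.2 h).le
  change G.edist x u ≤ ((s + 1 : ℕ) : ℕ∞)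
  push_cast
  exact SimpleGraph.edist_triangle.trans (add_le_add h1 h2)

theorem exists_adj_of_mem_cball_succ {s : ℕ} {y : V} (hy : y ∈ cball G x (s + 1)) :
    y ∈ cball G x s ∨ ∃ u ∈ cball G x s, G.Adj u y := by
  have h1 : G.edist x y ≤ ((s + 1 : ℕ) : ℕ∞) := hy
  obtain ⟨p, hp⟩ := SimpleGraph.exists_walk_of_edist_ne_top
    (ne_top_of_le_ne_top (ENat.natCast_ne_top _) h1)
  rw [← hp, Nat.cast_le] at h1
  rw [← p.length_reverse] at h1
  generalize p.reverse = q at h1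
  cases q with
  | nil => exact Or.inl (mem_cball_self _ _ _)
  | cons h q =>
    refine Or.inr ⟨_, ?_, h.symm⟩
    rw [SimpleGraph.Walk.length_cons] at h1
    change G.edist x _ ≤ _
    rw [SimpleGraph.edist_comm]
    exact (SimpleGraph.edist_le q).trans (Nat.cast_le.2 (by omega))

/-- The image in the tree of a vertex of the ball. -/
def ballMap (ρ : BallIso G d x R) (y : cball G x R) : TreeVertex d := (ρ.1 y).1

theorem ballMap_injective (ρ : BallIso G d x R) : Function.Injective (ballMap ρ) :=
  Subtype.val_injective.comp ρ.1.injective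

theorem ballMap_adj (ρ : BallIso G d x R) {y u : cball G x R} (h : G.Adj y u) :
    (tree d).Adj (ballMap ρ y) (ballMap ρ u) :=
  ρ.1.map_adj_iff.2 h

/-- Inside the ball, the isomorphism maps neighbourhoods onto neighbourhoods, as the degrees agree;
hence it intertwines the walks. -/
theorem srwOp_ballMap (hd : d ≠ 0) (hG : ∀ x, deg G x = d) (ρ : BallIso G d x R) {s : ℕ}
    (hs : s < R) (y : cball G x R) (hy : y.1 ∈ cball G x s) {F : V → ℝ} {F' : TreeVertex d → ℝ}
    (h : ∀ u : cball G x R, G.Adj y u → u.1 ∈ cball G x (s + 1) → F u = F' (ballMap ρ u)) :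
    srwOp G F y = srwOp (tree d) F' (ballMap ρ y) := by
  have hy0 : deg G y.1 ≠ 0 := by rwa [hG]
  have hy0' : deg (tree d) (ballMap ρ y) ≠ 0 := by rwa [deg_tree hd]
  rw [srwOp_eq_sum hy0, srwOp_eq_sum hy0', hG, deg_tree hd]
  have hadj : ∀ u ∈ (finite_neighborSet hy0).toFinset, G.Adj y u := fun u hu => by simpa using hu
  have hmem : ∀ u ∈ (finite_neighborSet hy0).toFinset, u ∈ cball G x (s + 1) := fun u hu =>
    mem_cball_succ_of_adj hy (hadj u hu)
  have hmemR : ∀ u ∈ (finite_neighborSet hy0).toFinset, u ∈ cball G x R := fun u hu =>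
    cball_mono hs (hmem u hu)
  congr 1
  have hi : ∀ u hu, ballMap ρ ⟨u, hmemR u hu⟩ ∈ (finite_neighborSet hy0').toFinset :=
    fun u hu => by simpa using ballMap_adj ρ (y := y) (u := ⟨u, hmemR u hu⟩) (hadj u hu)
  have hinj : ∀ u hu v hv, ballMap ρ ⟨u, hmemR u hu⟩ = ballMap ρ ⟨v, hmemR v hv⟩ → u = v :=
    fun u hu v hv e => congrArg Subtype.val (ballMap_injective ρ e)
  refine Finset.sum_bij (fun u hu => ballMap ρ ⟨u, hmemR u hu⟩) hi hinj (fun v hv => ?_)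
    fun u hu => h ⟨u, hmemR u hu⟩ (hadj u hu) (hmem u hu)
  obtain ⟨u, hu, e⟩ := Finset.surj_on_of_inj_on_of_card_le
    (fun u hu => ballMap ρ ⟨u, hmemR u hu⟩) hi (fun u v hu hv e => hinj u hu v hv e)
    (by rw [card_neighbors hy0, card_neighbors hy0', hG, deg_tree hd]) v hv
  exact ⟨u, hu, e.symm⟩

theorem lazyOp_iterate_ballMap (hd : d ≠ 0) (hG : ∀ x, deg G x = d) (ρ : BallIso G d x R) {t : ℕ}
    (ht : t ≤ R) {F : V → ℝ} {F' : TreeVertex d → ℝ}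
    (h : ∀ u : cball G x R, u.1 ∈ cball G x t → F u = F' (ballMap ρ u)) (j s : ℕ)
    (hsj : s + j ≤ t) (y : cball G x R) (hy : y.1 ∈ cball G x s) :
    (lazyOp G)^[j] F y = (lazyOp (tree d))^[j] F' (ballMap ρ y) := by
  induction j generalizing s y with
  | zero => exact h y (cball_mono (by omega) hy)
  | succ j ih =>
    rw [Function.iterate_succ_apply', Function.iterate_succ_apply', lazyOp, lazyOp,
      ih s (by omega) y hy, srwOp_ballMap hd hG ρ (s := s) (by omega) y hy
        fun u _ hu => ih (s + 1) (by omega) u hu]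

/-- Up to time `2 r`, the walk on the subdivided graph started in the ball of radius `r` does not
leave the subdivided ball of radius `2 r`. -/
theorem zeta_ballMap {r : ℕ} (hd : d ≠ 0) (hG : ∀ x, deg G x = d) (ρ : BallIso G d x (2 * r))
    {f : SubdivVertex G → ℝ} {g : SubdivVertex (tree d) → ℝ}
    (hfg : ∀ u, g (ballIsoExt ρ u) = f (ballIncl G x (2 * r) u)) {k : ℕ} (hk : k ≤ 2 * r)
    (y : cball G x (2 * r)) (hy : y.1 ∈ cball G x r) :
    zeta G k f y = zeta (tree d) k g (ballMap ρ y) := by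
  have hG' : ∀ x, deg G x ≠ 0 := fun x => by rwa [hG]
  have hT' : ∀ x, deg (tree d) x ≠ 0 := fun x => by rwa [deg_tree hd]
  rcases Nat.even_or_odd' k with ⟨j, rfl | rfl⟩
  · rw [zeta, zeta, srwOp_subdiv_iterate_two_mul_apply hT', srwOp_subdiv_iterate_two_mul_apply hG']
    exact lazyOp_iterate_ballMap hd hG ρ le_rfl (fun u _ => (hfg (Sum.inl u)).symm) j r (by omega)
      y hy
  · rw [zeta, zeta, Function.iterate_add_apply, Function.iterate_add_apply,
      srwOp_subdiv_iterate_two_mul_apply hT', srwOp_subdiv_iterate_two_mul_apply hG']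
    refine lazyOp_iterate_ballMap hd hG ρ (t := 2 * r - 1) (by omega) (fun u hu => ?_) j r
      (by omega) y hy
    simp only [Function.iterate_one, Function.comp_apply, srwOp_subdiv_inl]
    refine srwOp_ballMap hd hG ρ (s := 2 * r - 1) (by omega) u hu fun w huw _ => ?_
    rw [edgeFn_of_adj _ huw, edgeFn_of_adj _ (ballMap_adj ρ huw)]
    exact (hfg (Sum.inr ⟨s(u, w), huw⟩)).symm

theorem length_ballMap_le (ρ : BallIso G d x R) (s : ℕ) (hs : s ≤ R) (y : cball G x R)
    (hy : y.1 ∈ cball G x s) : (ballMap ρ y).1.length ≤ s := by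
  induction s generalizing y with
  | zero =>
    have h1 : G.edist x y.1 ≤ ((0 : ℕ) : ℕ∞) := hy
    have h2 : x = y.1 := by simpa using h1
    have h3 : y = ⟨x, mem_cball_self G x R⟩ := Subtype.ext h2.symm
    rw [h3, ballMap, ρ.2]
    simp [root]
  | succ s ih =>
    rcases exists_adj_of_mem_cball_succ hy with h | ⟨u, hu, huy⟩
    · exact (ih (by omega) y h).trans (Nat.le_succ s)
    · have h1 := ih (by omega) ⟨u, cball_mono (by omega) hu⟩ hu
      rcases ballMap_adj ρ (y := ⟨u, cball_mono (by omega) hu⟩) (u := y) huy with ⟨a, h⟩ | ⟨a, h⟩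
      · rw [h, List.length_cons] at h1
        omega
      · rw [h, List.length_cons]
        omega

/-- The words of length `n` which can follow the letter `b` in a vertex of the tree. -/
def wordsAfter (d : ℕ) : ℕ → Fin d → Finset (List (Fin d))
  | 0, _ => {[]}
  | n + 1, b => (Finset.univ.erase b).biUnion fun a => (wordsAfter d n a).image (a :: ·)

theorem card_wordsAfter_le (n : ℕ) (b : Fin d) : (wordsAfter d n b).card ≤ (d - 1) ^ n := by
  induction n generalizing b with
  | zero => simp [wordsAfter]
  | succ n ih =>
    rw [wordsAfter, pow_succ']
    refine (Finset.card_biUnion_le_card_mul _ _ _ fun a _ =>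
      Finset.card_image_le.trans (ih a)).trans ?_
    simp

theorem mem_wordsAfter (l : List (Fin d)) (b : Fin d)
    (h : (b :: l).IsChain (fun a b => a ≠ b)) : l ∈ wordsAfter d l.length b := by
  induction l generalizing b with
  | nil => simp [wordsAfter]
  | cons a l ih =>
    rw [List.isChain_cons_cons] at h
    rw [List.length_cons, wordsAfter, Finset.mem_biUnion]
    exact ⟨a, by simp [h.1.symm], Finset.mem_image_of_mem _ (ih a h.2)⟩

/-- The words of length at most `r` contain the ball of radius `r` in the tree. -/
def wordsUpTo (d : ℕ) : ℕ → Finset (List (Fin d))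
  | 0 => {[]}
  | r + 1 => wordsUpTo d r ∪
      Finset.univ.biUnion fun a => (wordsAfter d r a).image (a :: ·)

theorem mem_wordsUpTo (r : ℕ) (v : TreeVertex d) (h : v.1.length ≤ r) : v.1 ∈ wordsUpTo d r := by
  induction r with
  | zero => simpa [wordsUpTo] using h
  | succ r ih =>
    rw [wordsUpTo, Finset.mem_union]
    rcases Nat.lt_or_ge v.1.length (r + 1) with h' | h'
    · exact Or.inl (ih (by omega))
    · right
      obtain ⟨w, hw⟩ := v
      cases w with
      | nil => simp at h'
      | cons a l =>
        have hl : l.length = r := by simp only [List.length_cons] at h h'; omega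
        have := mem_wordsAfter l a hw
        rw [hl] at this
        exact Finset.mem_biUnion.2 ⟨a, Finset.mem_univ a, Finset.mem_image_of_mem _ this⟩

theorem card_wordsUpTo_le (hd : 3 ≤ d) (r : ℕ) : (wordsUpTo d r).card ≤ d * (d - 1) ^ r := by
  induction r with
  | zero => simp [wordsUpTo]; omega
  | succ r ih =>
    have h1 : (Finset.univ.biUnion fun a => (wordsAfter d r a).image (a :: ·)).card ≤
        d * (d - 1) ^ r := by
      refine (Finset.card_biUnion_le_card_mul _ _ _ fun a _ =>
        Finset.card_image_le.trans (card_wordsAfter_le r a)).trans ?_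
      simp
    calc (wordsUpTo d (r + 1)).card ≤ d * (d - 1) ^ r * 2 := by
          rw [wordsUpTo]
          exact (Finset.card_union_le _ _).trans (by omega)
      _ ≤ d * (d - 1) ^ r * (d - 1) := Nat.mul_le_mul_left _ (by omega)
      _ = d * (d - 1) ^ (r + 1) := by rw [pow_succ, mul_assoc]

theorem card_ball_le [Fintype V] (hd : 3 ≤ d) {r : ℕ} (ρ : BallIso G d x R) (hr : r ≤ R) :
    Nat.card {y : cball G x R // y.1 ∈ cball G x r} ≤ d * (d - 1) ^ r := by
  classical
  have hf : Function.Injective fun y : {y : cball G x R // y.1 ∈ cball G x r} =>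
      (⟨(ballMap ρ y.1).1, mem_wordsUpTo r _ (length_ballMap_le ρ r hr y.1 y.2)⟩ :
        {w // w ∈ wordsUpTo d r}) := fun y y' h =>
    Subtype.ext (ballMap_injective ρ (Subtype.ext (Subtype.mk.inj h)))
  refine (Nat.card_le_card_of_injective _ hf).trans ?_
  simpa using card_wordsUpTo_le hd r

end Ball

/-! ### Comparison of the coupled fields -/

section Comparison

variable {V : Type*} [Fintype V] {G : SimpleGraph V} {d r : ℕ} {β : ℝ} {x : V}
  {Ω : Type*} [MeasurableSpace Ω] {μ : Measure Ω} [IsProbabilityMeasure μ]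

/-- The layers `k ≤ 2 r` of the two fields differ only by the averages over `V`, which give the
first term; the remaining layers of the two fields give the second one. -/
theorem measureReal_abs_sub_gt_le (hd : 3 ≤ d) (hG : ∀ x, deg G x = d) (hβ : 0 < β)
    (hgap : β ≤ spectralGap G) (ρ : BallIso G d x (2 * r))
    {Z : ℕ → SubdivVertex G → Ω → ℝ} {W : ℕ → SubdivVertex (tree d) → Ω → ℝ}
    (hZ : IsNoise μ G ((d : ℝ) / 2) Z) (hW : IsNoise μ (tree d) ((d : ℝ) / 2) W)
    {Ψ : V → Ω → ℝ} {φ : TreeVertex d → Ω → ℝ}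
    (hΨ : ∀ᵐ ω ∂μ, ∀ y, HasSum (fun k => xi G k (fun z => Z k z ω) y) (Ψ y ω))
    (hφ : ∀ᵐ ω ∂μ, ∀ v, HasSum (fun k => zeta (tree d) k (fun z => W k z ω) v) (φ v ω))
    (hagree : ∀ᵐ ω ∂μ, ∀ k ≤ 2 * r, ∀ u,
      W k (ballIsoExt ρ u) ω = Z k (ballIncl G x (2 * r) u) ω)
    (y : cball G x (2 * r)) (hy : y.1 ∈ cball G x r) {ε : ℝ} (hε : 0 < ε) :
    μ.real {ω | ε < |Ψ y ω - φ (ballMap ρ y) ω|} ≤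
      2 * Real.exp (-(ε ^ 2 * Fintype.card V / (9 * ((r : ℝ) + 1)))) +
      4 * Real.exp (-((1 - decayRate d β) / 16 * ε ^ 2 / decayRate d β ^ (2 * r))) := by
  have hd0 : d ≠ 0 := by omega
  have hθ0 := decayRate_pos hd β
  have hθ1 := decayRate_lt_one hd hβ
  set θ := decayRate d β with hθ
  have : Nonempty V := ⟨x⟩
  have hN : (0 : ℝ) < Fintype.card V := Nat.cast_pos.2 Fintype.card_pos
  set m := 2 * r + 1 with hm
  set A : Ω → ℝ := fun ω => ∑ k ∈ Finset.range m,
    (∑ v, zeta G k (fun z => Z k z ω) v) / (Fintype.card V : ℝ) with hA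
  set B : Ω → ℝ := fun ω => ∑' k, xi G (k + m) (fun z => Z (k + m) z ω) y with hB
  set D : Ω → ℝ := fun ω => ∑' k, zeta (tree d) (k + m) (fun z => W (k + m) z ω) (ballMap ρ y)
    with hD
  -- Splitting `ε = ε / 2 + ε / 4 + ε / 4` suffices because `4 (2 r + 1) ≤ 9 (r + 1)`.
  have hsub : {ω | ε < |Ψ y ω - φ (ballMap ρ y) ω|} ≤ᵐ[μ]
      ({ω | ε / 2 < |A ω|} ∪ ({ω | ε / 4 < |B ω|} ∪ {ω | ε / 4 < |D ω|}) : Set Ω) := by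
    filter_upwards [hΨ, hφ, hagree] with ω h1 h2 h3 (hω : ε < _)
    have e1 := (h1 y).summable.sum_add_tsum_nat_add m
    rw [(h1 y).tsum_eq] at e1
    have e2 := (h2 (ballMap ρ y)).summable.sum_add_tsum_nat_add m
    rw [(h2 (ballMap ρ y)).tsum_eq] at e2
    have e3 : ∑ k ∈ Finset.range m, xi G k (fun z => Z k z ω) y =
        ∑ k ∈ Finset.range m, zeta (tree d) k (fun z => W k z ω) (ballMap ρ y) - A ω := by
      rw [hA, ← Finset.sum_sub_distrib]
      refine Finset.sum_congr rfl fun k hk => ?_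
      have hk' : k ≤ 2 * r := by rw [Finset.mem_range] at hk; omega
      rw [xi_eq hd0 hG, zeta_ballMap (g := fun z => W k z ω) hd0 hG ρ (h3 k hk') hk' y hy]
    have e4 : Ψ y ω - φ (ballMap ρ y) ω = -A ω + B ω - D ω := by
      rw [← e1, ← e2, e3]
      ring
    rw [e4] at hω
    change ε / 2 < |A ω| ∨ ε / 4 < |B ω| ∨ ε / 4 < |D ω|
    by_contra! hcon
    have h5 := abs_sub (-A ω + B ω) (D ω)
    have h6 := abs_add_le (-A ω) (B ω)
    rw [abs_neg] at h6
    linarith [hcon.1, hcon.2.1, hcon.2.2]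
  have hAle : μ.real {ω | ε / 2 < |A ω|} ≤
      2 * Real.exp (-(ε ^ 2 * Fintype.card V / (9 * ((r : ℝ) + 1)))) := by
    have hmr : (m : ℝ) = 2 * r + 1 := by rw [hm]; push_cast; ring
    have hmpos : (0 : ℝ) < m := by rw [hmr]; positivity
    refine ((hZ.isCentredGaussianField_average hd0 hG m).measure_abs_gt_le () le_rfl
      (by positivity) (ε := ε / 2) (by positivity)).trans ?_
    gcongr
    rw [neg_div, neg_le_neg_iff]
    have e : (ε / 2) ^ 2 / (2 * ((m : ℝ) / (2 * (Fintype.card V : ℝ)))) =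
        ε ^ 2 * Fintype.card V / (4 * m) := by field_simp; norm_num
    rw [e, hmr]
    refine div_le_div_of_nonneg_left (by positivity) (by positivity) ?_
    linarith [(Nat.cast_nonneg r : (0 : ℝ) ≤ r)]
  have hexp : Real.exp (-((ε / 4) ^ 2 * (1 - θ) / θ ^ m)) ≤
      Real.exp (-((1 - θ) / 16 * ε ^ 2 / θ ^ (2 * r))) := by
    refine Real.exp_le_exp.2 (neg_le_neg ?_)
    have h1 : 0 < 1 - θ := by linarith
    have e : (ε / 4) ^ 2 * (1 - θ) = (1 - θ) / 16 * ε ^ 2 := by ring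
    rw [e]
    exact div_le_div_of_nonneg_left (by positivity) (by positivity)
      (pow_le_pow_of_le_one hθ0.le hθ1.le (by omega))
  have hBle : μ.real {ω | ε / 4 < |B ω|} ≤ _ :=
    (hZ.isCentredGaussianField_xi hd0 hG).measure_abs_tsum_add_gt_le
      (M := fun k x y => (lazyProb G k x y - 1 / (Fintype.card V : ℝ)) / 2) hθ0 hθ1
      (lazyProb_sub_le_decayRate hd hG hgap) m y.1 (ε := ε / 4) (by positivity)
  have hDle : μ.real {ω | ε / 4 < |D ω|} ≤ _ :=
    (hW.isCentredGaussianField_zeta hd0 (deg_tree hd0)).measure_abs_tsum_add_gt_le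
      (M := fun k v w => lazyProb (tree d) k v w / 2) hθ0 hθ1
      (tree_lazyProb_self_le_decayRate hd β) m (ballMap ρ y) (ε := ε / 4) (by positivity)
  calc _ ≤ μ.real ({ω | ε / 2 < |A ω|} ∪ ({ω | ε / 4 < |B ω|} ∪ {ω | ε / 4 < |D ω|})) :=
        ENNReal.toReal_mono (measure_ne_top _ _) (measure_mono_ae hsub)
    _ ≤ μ.real {ω | ε / 2 < |A ω|} + (μ.real {ω | ε / 4 < |B ω|} + μ.real {ω | ε / 4 < |D ω|}) :=
        (measureReal_union_le _ _).trans (add_le_add le_rfl (measureReal_union_le _ _))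
    _ ≤ _ := by linarith

theorem measureReal_maxDiff_gt_le (hd : 3 ≤ d) (ρ : BallIso G d x (2 * r)) {Ψ : V → Ω → ℝ}
    {φ : TreeVertex d → Ω → ℝ} {ε b : ℝ} (hb : 0 ≤ b)
    (h : ∀ y : cball G x (2 * r), y.1 ∈ cball G x r →
      μ.real {ω | ε < |Ψ y ω - φ (ballMap ρ y) ω|} ≤ b) :
    μ.real {ω | ε < maxDiff ρ (fun y => Ψ y ω) (fun v => φ v ω)} ≤ d * ((d : ℝ) - 1) ^ r * b := by
  classical
  have hne : Nonempty {y : cball G x (2 * r) // y.1 ∈ cball G x r} :=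
    ⟨⟨⟨x, mem_cball_self G x _⟩, mem_cball_self G x _⟩⟩
  have hcard : (Fintype.card {y : cball G x (2 * r) // y.1 ∈ cball G x r} : ℝ) ≤
      d * ((d : ℝ) - 1) ^ r := by
    rw [← Nat.card_eq_fintype_card]
    have h1 := card_ball_le hd ρ (r := r) (by omega)
    have h2 : ((d - 1 : ℕ) : ℝ) = (d : ℝ) - 1 := by rw [Nat.cast_sub (by omega)]; simp
    rw [← h2]
    exact_mod_cast h1
  have hsub : {ω | ε < maxDiff ρ (fun y => Ψ y ω) (fun v => φ v ω)} ⊆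
      ⋃ y : {y : cball G x (2 * r) // y.1 ∈ cball G x r},
        {ω | ε < |Ψ y.1 ω - φ (ballMap ρ y.1) ω|} := fun ω hω => by
    obtain ⟨y, hy⟩ := exists_lt_of_lt_ciSup (show ε < iSup _ from hω)
    exact Set.mem_iUnion.2 ⟨y, hy⟩
  refine (measureReal_mono hsub).trans ((measureReal_iUnion_fintype_le _).trans
    ((Finset.sum_le_sum fun y _ => h y.1 y.2).trans ?_))
  rw [Finset.sum_const, Finset.card_univ, nsmul_eq_mul]
  exact mul_le_mul_of_nonneg_right hcard hb

/-- The quantitative estimate for the coupling, in terms of the decay rate of the lazy walk. -/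
theorem IsCoupling.measureReal_max_maxDiff_gt_le (hd : 3 ≤ d) (hG : ∀ x, deg G x = d) (hβ : 0 < β)
    (hgap : β ≤ spectralGap G) {x' : V} {ρ : BallIso G d x (2 * r)} {ρ' : BallIso G d x' (2 * r)}
    {Ψ : V → Ω → ℝ} {φ φ' : TreeVertex d → Ω → ℝ} {Z : ℕ → SubdivVertex G → Ω → ℝ}
    {W W' : ℕ → SubdivVertex (tree d) → Ω → ℝ}
    (h : IsCoupling μ G d (2 * r) x x' ρ ρ' Ψ φ φ' Z W W') {ε : ℝ} (hε : 0 < ε) {E : ℝ}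
    (hE : Real.exp (-((1 - decayRate d β) / 16 * ε ^ 2 / decayRate d β ^ (2 * r))) ≤ E) :
    μ.real {ω | ε < max (maxDiff ρ (fun y => Ψ y ω) (fun v => φ v ω))
        (maxDiff ρ' (fun y => Ψ y ω) (fun v => φ' v ω))} ≤
      8 * d * ((d : ℝ) - 1) ^ r *
        (E + Real.exp (-(ε ^ 2 * Fintype.card V / (9 * ((r : ℝ) + 1))))) := by
  have hE0 := Real.exp_pos (-((1 - decayRate d β) / 16 * ε ^ 2 / decayRate d β ^ (2 * r)))
  set F := Real.exp (-(ε ^ 2 * Fintype.card V / (9 * ((r : ℝ) + 1)))) with hF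
  have hF0 : 0 < F := Real.exp_pos _
  have h3 : (3 : ℝ) ≤ d := by exact_mod_cast hd
  have h1 := measureReal_maxDiff_gt_le (μ := μ) (ε := ε) hd ρ (b := 2 * F + 4 * E)
    (by linarith) fun y hy => (measureReal_abs_sub_gt_le hd hG hβ hgap ρ h.noise h.treeNoise
      h.repr h.treeRepr h.agree y hy hε).trans (by linarith)
  have h2 := measureReal_maxDiff_gt_le (μ := μ) (ε := ε) hd ρ' (b := 2 * F + 4 * E)
    (by linarith) fun y hy => (measureReal_abs_sub_gt_le hd hG hβ hgap ρ' h.noise h.treeNoise'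
      h.repr h.treeRepr' h.agree' y hy hε).trans (by linarith)
  have hP : 0 ≤ d * ((d : ℝ) - 1) ^ r * F :=
    mul_nonneg (mul_nonneg (by linarith) (pow_nonneg (by linarith) r)) hF0.le
  have hset : {ω | ε < max (maxDiff ρ (fun y => Ψ y ω) (fun v => φ v ω))
        (maxDiff ρ' (fun y => Ψ y ω) (fun v => φ' v ω))} =
      {ω | ε < maxDiff ρ (fun y => Ψ y ω) (fun v => φ v ω)} ∪
        {ω | ε < maxDiff ρ' (fun y => Ψ y ω) (fun v => φ' v ω)} := by
    ext ω
    exact lt_max_iff (α := ℝ)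
  rw [hset]
  refine (measureReal_union_le _ _).trans ((add_le_add h1 h2).trans ?_)
  linarith

end Comparison

end GFFCoupling

end

theorem proposition4p1 (d : ℕ) (hd : 3 ≤ d) (α β : ℝ) (hα₀ : 0 < α) (hα₁ : α < 1) (hβ : 0 < β) :
    ∃ c C κ : ℝ, ∃ r₀ : ℕ, 0 < c ∧ 0 < C ∧ 0 < κ ∧
      ∀ (V : ℕ → Type*) (G : ∀ n, SimpleGraph (V n)) (N : ℕ → ℕ),
        GFFCoupling.GraphAssumption d α β V G N →
      ∀ (n r : ℕ) (x x' : V n),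
        GFFCoupling.Treelike (G n) (2 * r) x → GFFCoupling.Treelike (G n) (2 * r) x' →
        Disjoint (GFFCoupling.cball (G n) x (2 * r)) (GFFCoupling.cball (G n) x' (2 * r)) →
      ∀ (ρ : GFFCoupling.BallIso (G n) d x (2 * r)) (ρ' : GFFCoupling.BallIso (G n) d x' (2 * r)),
      ∃ (Ω : Type) (_ : MeasurableSpace Ω) (Q : MeasureTheory.Measure Ω)
        (Ψ : V n → Ω → ℝ) (φ φ' : GFFCoupling.TreeVertex d → Ω → ℝ)
        (Z : ℕ → GFFCoupling.SubdivVertex (G n) → Ω → ℝ)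
        (W W' : ℕ → GFFCoupling.SubdivVertex (GFFCoupling.tree d) → Ω → ℝ),
        MeasureTheory.IsProbabilityMeasure Q ∧
        GFFCoupling.IsCoupling Q (G n) d (2 * r) x x' ρ ρ' Ψ φ φ' Z W W' ∧
        ∀ ε : ℝ, 0 < ε →
          Q.real {ω | ε < max (GFFCoupling.maxDiff ρ (fun y => Ψ y ω) (fun v => φ v ω))
              (GFFCoupling.maxDiff ρ' (fun y => Ψ y ω) (fun v => φ' v ω))} ≤
            C * d * ((d : ℝ) - 1) ^ r *
              (Real.exp (-(κ * ε ^ 2 * Real.exp (c * r) / 18)) +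
                Real.exp (-(ε ^ 2 * N n / (9 * ((r : ℝ) + 1))))) ∧
          (r₀ ≤ r →
            Q.real {ω | ε < max (GFFCoupling.maxDiff ρ (fun y => Ψ y ω) (fun v => φ v ω))
                (GFFCoupling.maxDiff ρ' (fun y => Ψ y ω) (fun v => φ' v ω))} ≤
              C * d * ((d : ℝ) - 1) ^ r *
                (Real.exp (-(ε ^ 2 * Real.exp (c * r) / 18)) +
                  Real.exp (-(ε ^ 2 * N n / (9 * ((r : ℝ) + 1)))))) := by
  have hθ0 := GFFCoupling.decayRate_pos hd β
  have hθ1 := GFFCoupling.decayRate_lt_one hd hβ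
  set θ := GFFCoupling.decayRate d β with hθ
  have h1θ : 0 < 1 - θ := by linarith
  obtain ⟨r₀, hr₀⟩ := eventually_atTop.1 ((tendsto_pow_atTop_nhds_zero_of_lt_one hθ0.le
    hθ1).eventually_le_const (u := 18 * ((1 - θ) / 16)) (by positivity))
  -- With this `c`, the decay `θ ^ (2 r)` of the variances is `exp (-2 c r)`; one of the two factors
  -- `exp (c r)` in the exponent absorbs the constant `κ` for large `r`.
  refine ⟨-Real.log θ, 8, 18 * ((1 - θ) / 16), r₀, neg_pos.2 (Real.log_neg hθ0 hθ1), by norm_num,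
    by positivity, fun V G N hA n r x x' _ _ hdisj ρ ρ' => ?_⟩
  have := hA.finite n
  let := Fintype.ofFinite (V n)
  have hN : N n = Fintype.card (V n) := by rw [← hA.card n, Nat.card_eq_fintype_card]
  obtain ⟨Ω, mΩ, Q, Ψ, φ, φ', Z, W, W', hQ, hc⟩ :=
    GFFCoupling.exists_isCoupling hd (hA.regular n) hβ (hA.gap n) hdisj ρ ρ'
  refine ⟨Ω, mΩ, Q, Ψ, φ, φ', Z, W, W', hQ, hc, fun ε hε => ?_⟩
  have hexp : Real.exp (-Real.log θ * r) = (θ ^ r)⁻¹ := by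
    rw [neg_mul, Real.exp_neg, mul_comm, Real.exp_nat_mul, Real.exp_log hθ0]
  have hpow : 0 < θ ^ r := pow_pos hθ0 r
  have hpow1 : θ ^ r ≤ 1 := pow_le_one₀ hθ0.le hθ1.le
  have hsq : (1 - θ) / 16 * ε ^ 2 / θ ^ (2 * r) = (1 - θ) / 16 * ε ^ 2 * (θ ^ r)⁻¹ * (θ ^ r)⁻¹ := by
    rw [two_mul, pow_add]
    field_simp
  rw [hN, hexp]
  refine ⟨hc.measureReal_max_maxDiff_gt_le hd (hA.regular n) hβ (hA.gap n) hε ?_,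
    fun hr => hc.measureReal_max_maxDiff_gt_le hd (hA.regular n) hβ (hA.gap n) hε ?_⟩
  all_goals
    rw [← hθ, hsq]
    refine Real.exp_le_exp.2 (neg_le_neg ?_)
  · have h1 : 1 ≤ (θ ^ r)⁻¹ := (one_le_inv₀ hpow).2 hpow1
    calc _ = (1 - θ) / 16 * ε ^ 2 * (θ ^ r)⁻¹ := by ring
      _ ≤ _ := le_mul_of_one_le_right (by positivity) h1
  · have h1 : 1 ≤ 18 * ((1 - θ) / 16) * (θ ^ r)⁻¹ := by
      rw [← div_eq_mul_inv, one_le_div hpow]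
      exact hr₀ r hr
    calc _ ≤ ε ^ 2 * (θ ^ r)⁻¹ / 18 * (18 * ((1 - θ) / 16) * (θ ^ r)⁻¹) :=
          le_mul_of_one_le_right (by positivity) h1
      _ = _ := by ring
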